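/- Let $\omega>0$, $B>0$ and $\lambda=-2\omega$, and let $A=(A_1,A_2)\in C^1(\mathbb R^2;\mathbb R^2)$ be any vector potential of the homogeneous magnetic field $B$, i.e. $\partial_xA_2-\partial_yA_1=B$ (for instance $A=(-By,0)$ or $A=(0,Bx)$). Consider in $L^2(\mathbb R^2)$ the operator $$\dot H v=(i\nabla+A)^2v+\omega^2y^2v\qquad (x\neq0),$$ which corresponds to the formal expression $(i\nabla+A)^2+\omega^2y^2+\lambda y\,\delta(x)$, on the domain $\mathcal D_0$ of all functions $v:\mathbb R^2\to\mathbb C$ which are twice continuously differentiable on each of the closed half-planes $\{x\ge0\}$ and $\{x\le0\}$ (hence continuous across the line $x=0$), satisfy the matching condition $$\frac{\partial v}{\partial x}(0+,y)-\frac{\partial v}{\partial x}(0-,y)=\lambda y\,v(0,y)\qquad(y\in\mathbb R),$$ and are such that $v$, $(i\partial_x+A_1)v$, $(i\partial_y+A_2)v$, $yv$ and $\dot Hv$ belong to $L^2(\mathbb R^2)$. Then $\dot H$ is densely defined, symmetric and nonnegative, so that its Friedrichs extension $H_{\mathrm{Sm}}(A)$ is defined; $H_{\mathrm{Sm}}(A)$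 is self-adjoint, and $$\sigma(H_{\mathrm{Sm}}(A))=\sigma_{\mathrm{ess}}(H_{\mathrm{Sm}}(A))=[0,\infty).$$ Here $\sigma_{\mathrm{ess}}$ is the spectrum without the isolated eigenvalues of finite multiplicity. -/

import Mathlib

open MeasureTheory Filter Topology Set
open scoped ComplexConjugate

noncomputable section

namespace LinearPMap

/-! ### Unbounded operators in a complex Hilbert space -/

variable {E : Type*} [NormedAddCommGroup E] [InnerProductSpace ℂ E]

/-- `z` is in the resolvent set of `T` if `T - z` maps its domain bijectively onto the whole space
with a bounded inverse `R`. -/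
def IsResolventPoint (T : E →ₗ.[ℂ] E) (z : ℂ) : Prop :=
  ∃ R : E →L[ℂ] E,
    (∀ f : E, ∃ u : T.domain, (u : E) = R f ∧ T u - z • (u : E) = f) ∧
    (∀ u : T.domain, R (T u - z • (u : E)) = u)

/-- The spectrum `σ(T)` of an unbounded operator: the complement of the resolvent set. -/
def spectrumSet (T : E →ₗ.[ℂ] E) : Set ℂ := {z | ¬ T.IsResolventPoint z}

/-- The eigenspace `{u ∈ Dom T | T u = z u}`. -/
def eigenspaceAt (T : E →ₗ.[ℂ] E) (z : ℂ) : Submodule ℂ E :=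
  (LinearMap.ker (T.toFun - z • T.domain.subtype)).map T.domain.subtype

/-- The discrete spectrum: the isolated points of the spectrum that are eigenvalues of finite
multiplicity. -/
def discreteSpectrum (T : E →ₗ.[ℂ] E) : Set ℂ :=
  {z | z ∈ T.spectrumSet ∧ (∃ ε > 0, ∀ w ∈ T.spectrumSet, dist w z < ε → w = z) ∧
    T.eigenspaceAt z ≠ ⊥ ∧ FiniteDimensional ℂ (T.eigenspaceAt z)}

/-- The essential spectrum `σ_ess(T)` of a self-adjoint operator: the complement of the discrete
spectrum in the spectrum. -/
def essentialSpectrum (T : E →ₗ.[ℂ] E) : Set ℂ := T.spectrumSet \ T.discreteSpectrum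

/-- The quadratic form `q[u] = Re ⟨u, T u⟩` of an operator, on the domain of the operator. (The
inner product is real if `T` is symmetric.) -/
def form (T : E →ₗ.[ℂ] E) (u : T.domain) : ℝ := (inner ℂ (u : E) (T u)).re

/-- A densely defined, symmetric and nonnegative operator. -/
structure IsNonnegSymmetric (T : E →ₗ.[ℂ] E) : Prop where
  dense : Dense (T.domain : Set E)
  symmetric : T.IsFormalAdjoint T
  nonneg : ∀ u : T.domain, 0 ≤ T.form u

theorem form_add_le {T : E →ₗ.[ℂ] E} (h : T.IsNonnegSymmetric) (u v : T.domain) :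
    T.form (u + v) ≤ 2 * T.form u + 2 * T.form v := by
  have h1 := h.nonneg (u - v)
  simp only [form, LinearPMap.map_add, LinearPMap.map_sub, Submodule.coe_add,
    AddSubgroupClass.coe_sub, inner_add_left, inner_add_right, inner_sub_left, inner_sub_right,
    Complex.add_re, Complex.sub_re] at h1 ⊢
  linarith

theorem form_smul (T : E →ₗ.[ℂ] E) (c : ℂ) (u : T.domain) :
    T.form (c • u) = ‖c‖ ^ 2 * T.form u := by
  simp only [form, LinearPMap.map_smul, Submodule.coe_smul, inner_smul_left, inner_smul_right]
  rw [← mul_assoc, Complex.mul_conj, Complex.re_ofReal_mul, Complex.normSq_eq_norm_sq]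

/-- The form domain of the Friedrichs extension, i.e. the domain of the closure of the form `q`:
all limits `u` of sequences `vₙ` in the domain of `T` with `q[vₙ - vₘ] → 0`. -/
def formDomain (T : E →ₗ.[ℂ] E) (h : T.IsNonnegSymmetric) : Submodule ℂ E where
  carrier := {u | ∃ v : ℕ → T.domain, Tendsto (fun n => (v n : E)) atTop (𝓝 u) ∧
    Tendsto (fun p : ℕ × ℕ => T.form (v p.1 - v p.2)) atTop (𝓝 0)}
  zero_mem' := ⟨fun _ => 0, by simp, by simp [form]⟩
  add_mem' := by
    rintro a b ⟨v, hv, hv'⟩ ⟨w, hw, hw'⟩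
    refine ⟨fun n => v n + w n, by simpa using hv.add hw, ?_⟩
    have hlim : Tendsto (fun p : ℕ × ℕ => 2 * T.form (v p.1 - v p.2) +
        2 * T.form (w p.1 - w p.2)) atTop (𝓝 0) := by
      simpa using (hv'.const_mul 2).add (hw'.const_mul 2)
    refine squeeze_zero (fun p => h.nonneg _) (fun p => ?_) hlim
    have := form_add_le h (v p.1 - v p.2) (w p.1 - w p.2)
    rwa [sub_add_sub_comm] at this
  smul_mem' := by
    rintro c a ⟨v, hv, hv'⟩
    refine ⟨fun n => c • v n, by simpa using hv.const_smul c, ?_⟩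
    have hlim := hv'.const_mul (‖c‖ ^ 2)
    rw [mul_zero] at hlim
    refine hlim.congr (fun p => ?_)
    rw [← smul_sub, form_smul]

/-- The Friedrichs extension of a densely defined nonnegative symmetric operator `T`: the
restriction of the adjoint of `T` to the vectors which lie in the form domain. -/
def friedrichs [CompleteSpace E] (T : E →ₗ.[ℂ] E) (h : T.IsNonnegSymmetric) : E →ₗ.[ℂ] E :=
  T.adjoint.domRestrict (T.formDomain h)

end LinearPMap

namespace SmilanskySolomyak

/-! ### The magnetic Smilansky–Solomyak Hamiltonian -/

/-- The Hilbert space `L²(ℝ²)` of complex functions. -/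
abbrev L2Plane : Type := Lp ℂ 2 (volume : Measure (ℝ × ℝ))

/-- A `C¹` vector potential `A = (A₁, A₂)` of the homogeneous magnetic field `B` on the plane:
`∂₁A₂ - ∂₂A₁ = B`. -/
structure VectorPotential (B : ℝ) where
  A₁ : ℝ × ℝ → ℝ
  A₂ : ℝ × ℝ → ℝ
  contDiff₁ : ContDiff ℝ 1 A₁
  contDiff₂ : ContDiff ℝ 1 A₂
  curl : ∀ p, fderiv ℝ A₂ p (1, 0) - fderiv ℝ A₁ p (0, 1) = B

/-- The first order expression `(i ∂ₑ + a) v`. -/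
def momentum (a : ℝ × ℝ → ℝ) (e : ℝ × ℝ) (v : ℝ × ℝ → ℂ) (p : ℝ × ℝ) : ℂ :=
  Complex.I * fderiv ℝ v p e + (a p : ℂ) * v p

variable {B : ℝ}

/-- `(i ∂ₓ + A₁) v`, off the line `x = 0`. -/
def momentumX (A : VectorPotential B) (v : ℝ × ℝ → ℂ) : ℝ × ℝ → ℂ := momentum A.A₁ (1, 0) v

/-- `(i ∂_y + A₂) v`, off the line `x = 0`. -/
def momentumY (A : VectorPotential B) (v : ℝ × ℝ → ℂ) : ℝ × ℝ → ℂ := momentum A.A₂ (0, 1) v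

/-- The action `(i∇ + A)² v + ω² y² v` of the Hamiltonian off the line `x = 0`. (Its values on this
null line play no role.) -/
def hamiltonian (A : VectorPotential B) (ω : ℝ) (v : ℝ × ℝ → ℂ) (p : ℝ × ℝ) : ℂ :=
  momentumX A (momentumX A v) p + momentumY A (momentumY A v) p + (ω ^ 2 * p.2 ^ 2 : ℝ) * v p

/-- Membership in the initial domain `𝒟₀`: `v` is twice continuously differentiable on each of the
closed half-planes `x ≥ 0` and `x ≤ 0` (in particular continuous across the line `x = 0`), it
satisfies `∂ₓv(0+, y) - ∂ₓv(0-, y) = lam y v(0, y)`, and `v`, the image of `v` under the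
differential expression, and the functions in the associated quadratic form are in `L²`. -/
structure MemD0 (A : VectorPotential B) (ω lam : ℝ) (v : ℝ × ℝ → ℂ) : Prop where
  right : ContDiffOn ℝ 2 v {p | 0 ≤ p.1}
  left : ContDiffOn ℝ 2 v {p | p.1 ≤ 0}
  jump : ∀ y : ℝ, derivWithin (fun x : ℝ => v (x, y)) (Ici 0) 0 -
    derivWithin (fun x : ℝ => v (x, y)) (Iic 0) 0 = (lam * y : ℝ) * v (0, y)
  memLp : MemLp v 2 volume
  memLp_X : MemLp (momentumX A v) 2 volume
  memLp_Y : MemLp (momentumY A v) 2 volume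
  memLp_y : MemLp (fun p => (p.2 : ℂ) * v p) 2 volume
  memLp_hamiltonian : MemLp (hamiltonian A ω v) 2 volume

/-! #### Linearity off the line `x = 0` -/

theorem ae_fst_ne_zero : ∀ᵐ p : ℝ × ℝ, p.1 ≠ 0 := by
  have h : ∀ᵐ x : ℝ, x ≠ 0 := by simp [ae_iff]
  exact Measure.quasiMeasurePreserving_fst.ae h

theorem MemD0.contDiffAt {A : VectorPotential B} {ω lam : ℝ} {v : ℝ × ℝ → ℂ}
    (h : MemD0 A ω lam v) {p : ℝ × ℝ} (hp : p.1 ≠ 0) : ContDiffAt ℝ 2 v p := by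
  rcases lt_or_gt_of_ne hp with hp | hp
  · refine h.left.contDiffAt (mem_of_superset ((isOpen_Iio.preimage continuous_fst).mem_nhds hp) ?_)
    exact fun q hq => le_of_lt (by simpa using hq)
  · refine h.right.contDiffAt
      (mem_of_superset ((isOpen_Ioi.preimage continuous_fst).mem_nhds hp) ?_)
    exact fun q hq => le_of_lt (by simpa using hq)

theorem MemD0.continuous {A : VectorPotential B} {ω lam : ℝ} {v : ℝ × ℝ → ℂ}
    (h : MemD0 A ω lam v) : Continuous v := by
  have hc := h.right.continuousOn.union_of_isClosed h.left.continuousOn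
    (isClosed_le continuous_const continuous_fst) (isClosed_le continuous_fst continuous_const)
  rw [← continuousOn_univ]
  exact hc.mono fun p _ => le_total 0 p.1

theorem MemD0.diff_right {A : VectorPotential B} {ω lam : ℝ} {v : ℝ × ℝ → ℂ}
    (h : MemD0 A ω lam v) (y : ℝ) :
    DifferentiableWithinAt ℝ (fun x : ℝ => v (x, y)) (Ici 0) 0 := by
  have h1 : DifferentiableOn ℝ v {p | 0 ≤ p.1} := h.right.differentiableOn (by norm_num)
  exact DifferentiableWithinAt.comp (0 : ℝ) (f := fun x : ℝ => (x, y)) (t := {p | 0 ≤ p.1})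
    (h1 (0, y) (by simp)) (by fun_prop) (fun x hx => by simpa using hx)

theorem MemD0.diff_left {A : VectorPotential B} {ω lam : ℝ} {v : ℝ × ℝ → ℂ}
    (h : MemD0 A ω lam v) (y : ℝ) :
    DifferentiableWithinAt ℝ (fun x : ℝ => v (x, y)) (Iic 0) 0 := by
  have h1 : DifferentiableOn ℝ v {p | p.1 ≤ 0} := h.left.differentiableOn (by norm_num)
  exact DifferentiableWithinAt.comp (0 : ℝ) (f := fun x : ℝ => (x, y)) (t := {p | p.1 ≤ 0})
    (h1 (0, y) (by simp)) (by fun_prop) (fun x hx => by simpa using hx)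

theorem momentum_lin {a : ℝ × ℝ → ℝ} {e p : ℝ × ℝ} {v w : ℝ × ℝ → ℂ}
    (hv : DifferentiableAt ℝ v p) (hw : DifferentiableAt ℝ w p) (c : ℂ) :
    momentum a e (fun q => v q + c * w q) p = momentum a e v p + c * momentum a e w p := by
  have h : fderiv ℝ (fun q => v q + c * w q) p = fderiv ℝ v p + c • fderiv ℝ w p := by
    rw [fderiv_fun_add hv (hw.const_mul c), fderiv_const_mul hw]
  simp only [momentum, h, add_apply, smul_apply, smul_eq_mul]
  ring

theorem momentum_differentiableAt {a : ℝ × ℝ → ℝ} (ha : ContDiff ℝ 1 a) {e p : ℝ × ℝ}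
    {v : ℝ × ℝ → ℂ} (hv : ContDiffAt ℝ 2 v p) : DifferentiableAt ℝ (momentum a e v) p := by
  have h1 : DifferentiableAt ℝ (fun q => fderiv ℝ v q e) p :=
    ((hv.fderiv_right (m := 1) (by norm_num)).differentiableAt (by norm_num)).clm_apply
      (differentiableAt_const e)
  have h2 : DifferentiableAt ℝ (fun q => (a q : ℂ)) p :=
    Complex.ofRealCLM.differentiableAt.comp p (ha.differentiable (by norm_num) p)
  exact (h1.const_mul Complex.I).add (h2.mul (hv.differentiableAt (by norm_num)))

theorem momentum_momentum_lin {a : ℝ × ℝ → ℝ} (ha : ContDiff ℝ 1 a) {e p : ℝ × ℝ}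
    {v w : ℝ × ℝ → ℂ} (hv : ContDiffAt ℝ 2 v p) (hw : ContDiffAt ℝ 2 w p) (c : ℂ) :
    momentum a e (momentum a e (fun q => v q + c * w q)) p =
      momentum a e (momentum a e v) p + c * momentum a e (momentum a e w) p := by
  have hev : momentum a e (fun q => v q + c * w q) =ᶠ[𝓝 p]
      fun q => momentum a e v q + c * momentum a e w q := by
    filter_upwards [hv.eventually (by simp), hw.eventually (by simp)] with q hvq hwq
    exact momentum_lin (hvq.differentiableAt (by norm_num)) (hwq.differentiableAt (by norm_num)) c
  rw [← momentum_lin (momentum_differentiableAt ha hv) (momentum_differentiableAt ha hw) c]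
  conv_lhs => rw [momentum, hev.fderiv_eq, hev.eq_of_nhds]
  rfl

section Linear

variable {A : VectorPotential B} {ω lam : ℝ} {v w : ℝ × ℝ → ℂ}

theorem momentumX_lin (hv : MemD0 A ω lam v) (hw : MemD0 A ω lam w) (c : ℂ) :
    momentumX A (fun q => v q + c * w q) =ᵐ[volume]
      fun p => momentumX A v p + c * momentumX A w p := by
  filter_upwards [ae_fst_ne_zero] with p hp
  exact momentum_lin ((hv.contDiffAt hp).differentiableAt (by norm_num))
    ((hw.contDiffAt hp).differentiableAt (by norm_num)) c

theorem momentumY_lin (hv : MemD0 A ω lam v) (hw : MemD0 A ω lam w) (c : ℂ) :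
    momentumY A (fun q => v q + c * w q) =ᵐ[volume]
      fun p => momentumY A v p + c * momentumY A w p := by
  filter_upwards [ae_fst_ne_zero] with p hp
  exact momentum_lin ((hv.contDiffAt hp).differentiableAt (by norm_num))
    ((hw.contDiffAt hp).differentiableAt (by norm_num)) c

theorem hamiltonian_lin (hv : MemD0 A ω lam v) (hw : MemD0 A ω lam w) (c : ℂ) :
    hamiltonian A ω (fun q => v q + c * w q) =ᵐ[volume]
      fun p => hamiltonian A ω v p + c * hamiltonian A ω w p := by
  filter_upwards [ae_fst_ne_zero] with p hp
  have h1 := momentum_momentum_lin (e := (1, 0)) A.contDiff₁ (hv.contDiffAt hp)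
    (hw.contDiffAt hp) c
  have h2 := momentum_momentum_lin (e := (0, 1)) A.contDiff₂ (hv.contDiffAt hp)
    (hw.contDiffAt hp) c
  simp only [hamiltonian, momentumX, momentumY, h1, h2]
  ring

theorem MemD0.lin (hv : MemD0 A ω lam v) (hw : MemD0 A ω lam w) (c : ℂ) :
    MemD0 A ω lam (fun q => v q + c * w q) where
  right := hv.right.add (contDiffOn_const.mul hw.right)
  left := hv.left.add (contDiffOn_const.mul hw.left)
  jump y := by
    rw [derivWithin_fun_add (hv.diff_right y) ((hw.diff_right y).const_mul c),
      derivWithin_fun_add (hv.diff_left y) ((hw.diff_left y).const_mul c),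
      derivWithin_const_mul _ (hw.diff_right y), derivWithin_const_mul _ (hw.diff_left y)]
    linear_combination hv.jump y + c * hw.jump y
  memLp := hv.memLp.add (hw.memLp.const_mul c)
  memLp_X := (memLp_congr_ae (momentumX_lin hv hw c)).2 (hv.memLp_X.add (hw.memLp_X.const_mul c))
  memLp_Y := (memLp_congr_ae (momentumY_lin hv hw c)).2 (hv.memLp_Y.add (hw.memLp_Y.const_mul c))
  memLp_y := by
    refine (hv.memLp_y.add (hw.memLp_y.const_mul c)).ae_eq (Eventually.of_forall fun p => ?_)
    simp only [Pi.add_apply]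
    ring
  memLp_hamiltonian := (memLp_congr_ae (hamiltonian_lin hv hw c)).2
    (hv.memLp_hamiltonian.add (hw.memLp_hamiltonian.const_mul c))

end Linear

theorem momentum_zero (a : ℝ × ℝ → ℝ) (e : ℝ × ℝ) : momentum a e 0 = 0 := by
  ext p
  simp [momentum]

theorem memD0_zero (A : VectorPotential B) (ω lam : ℝ) : MemD0 A ω lam 0 where
  right := contDiffOn_const
  left := contDiffOn_const
  jump y := by simp
  memLp := MemLp.zero
  memLp_X := by rw [momentumX, momentum_zero]; exact MemLp.zero
  memLp_Y := by rw [momentumY, momentum_zero]; exact MemLp.zero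
  memLp_y := by simp
  memLp_hamiltonian := by
    have h : hamiltonian A ω 0 = 0 := by
      ext p
      simp [hamiltonian, momentumX, momentumY, momentum_zero]
    rw [h]
    exact MemLp.zero

/-- The initial domain `𝒟₀`, as a space of functions. -/
def D0 (A : VectorPotential B) (ω lam : ℝ) : Submodule ℂ (ℝ × ℝ → ℂ) where
  carrier := {v | MemD0 A ω lam v}
  zero_mem' := memD0_zero A ω lam
  add_mem' := by
    intro v w hv hw
    have h := MemD0.lin hv hw 1
    simp only [one_mul] at h
    exact h
  smul_mem' := by
    intro c v hv
    have h := MemD0.lin (memD0_zero A ω lam) hv c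
    simp only [Pi.zero_apply, zero_add] at h
    exact h

/-- The embedding of `𝒟₀` into `L²(ℝ²)`. -/
def D0.toL2 (A : VectorPotential B) (ω lam : ℝ) : D0 A ω lam →ₗ[ℂ] L2Plane where
  toFun v := MemLp.toLp v.1 v.2.memLp
  map_add' _ _ := rfl
  map_smul' _ _ := rfl

/-- The action of the Hamiltonian on `𝒟₀`, with values in `L²(ℝ²)`. -/
def D0.toL2Hamiltonian (A : VectorPotential B) (ω lam : ℝ) : D0 A ω lam →ₗ[ℂ] L2Plane where
  toFun v := MemLp.toLp (hamiltonian A ω v.1) v.2.memLp_hamiltonian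
  map_add' v w := by
    rw [← MemLp.toLp_add, MemLp.toLp_eq_toLp_iff]
    have h := hamiltonian_lin v.2 w.2 1
    simp only [one_mul] at h
    exact h
  map_smul' c v := by
    rw [RingHom.id_apply, ← MemLp.toLp_const_smul, MemLp.toLp_eq_toLp_iff]
    have h := hamiltonian_lin (memD0_zero A ω lam) v.2 c
    have h0 : hamiltonian A ω 0 = 0 := by
      ext p
      simp [hamiltonian, momentumX, momentumY, momentum_zero]
    simp only [h0, Pi.zero_apply, zero_add] at h
    exact h

theorem D0.toL2_injective (A : VectorPotential B) (ω lam : ℝ) :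
    Function.Injective (D0.toL2 A ω lam) := by
  intro v w h
  have h' : v.1 =ᵐ[volume] w.1 := (MemLp.toLp_eq_toLp_iff v.2.memLp w.2.memLp).1 h
  exact Subtype.ext ((Continuous.ae_eq_iff_eq volume v.2.continuous w.2.continuous).1 h')

/-- The operator `(i∇ + A)² + ω² y² + lam y δ(x)` in `L²(ℝ²)` with the initial domain `𝒟₀`. -/
def initialOperator (A : VectorPotential B) (ω lam : ℝ) : L2Plane →ₗ.[ℂ] L2Plane where
  domain := LinearMap.range (D0.toL2 A ω lam)
  toFun := (D0.toL2Hamiltonian A ω lam).comp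
    (LinearEquiv.ofInjective (D0.toL2 A ω lam) (D0.toL2_injective A ω lam)).symm.toLinearMap

end SmilanskySolomyak

end

noncomputable section

namespace LinearPMap

/-! ### The Friedrichs extension: nonnegativity and self-adjointness -/

section Abstract

variable {E : Type*} [NormedAddCommGroup E] [InnerProductSpace ℂ E] {T : E →ₗ.[ℂ] E}

/-! The coupling `lam = -2 * ω` is the one at which the `x`-part of the operator is a perfect
square. With `D = (i ∂ₓ + A₁) + i ω y sgn(x)`, the commutator of `i ∂ₓ` with `sgn(x)` produces
exactly `-2 ω y δ(x)`, so formally `H = D* D + (i ∂_y + A₂)²`. Rigorously, the matching condition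
says that `D v` is continuous across `x = 0` (`MemD0.factorX_trace`), so integration by parts on the
two half-planes leaves no boundary term (`MemD0.integral_hamiltonian`). Symmetry and nonnegativity
follow; density comes from test functions supported off the line.

For any densely defined nonnegative symmetric operator, the Friedrichs extension is symmetric and
nonnegative because the form converges along approximating sequences (`form_tendsto`), and adding 1
makes it surjective because a convex functional has a minimizer (`exists_weak_solution`). Hence it
is self-adjoint, and its spectrum lies in `[0, ∞)` (`IsSelfAdjoint.spectrumSet_subset`).

For the converse inclusion, choose a gauge in which the potential becomes `(0, B x - k)`
(`VectorPotential.exists_gauge`). The function `exp(i χ - ω y |x|)` is annihilated by `D` and, for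
`y > 0`, lives at distance about `1 / (ω y)` from the line. Cut off by a profile `f` on `N ≤ y ≤ 2
N`, it occupies a region of width about `1 / N` and length about `N`, so its norm does not
degenerate. There `i ∂_y + A₂` acts as `-k` up to terms containing a derivative of `f` or a factor
`x`, all of order `1 / N`. In particular the magnetic field disappears in the limit. These are
approximate eigenvectors for `k²` with `k` arbitrary (`exists_approx_eigenvector`), so the whole
half-line is spectrum. It has no isolated points, so all of it is essential. -/

theorem IsNonnegSymmetric.inner_comm (h : T.IsNonnegSymmetric) (u v : T.domain) :
    inner ℂ (v : E) (T u) = conj (inner ℂ (u : E) (T v)) := by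
  rw [inner_conj_symm, h.symmetric]

theorem IsNonnegSymmetric.inner_self (h : T.IsNonnegSymmetric) (u : T.domain) :
    inner ℂ (u : E) (T u) = (T.form u : ℂ) := by
  have := h.inner_comm u u
  rw [eq_comm, Complex.conj_eq_iff_re] at this
  exact this.symm

/-- The quadratic form of a nonnegative symmetric operator as a positive semidefinite sesquilinear
form on its domain. -/
abbrev formCore (h : T.IsNonnegSymmetric) : PreInnerProductSpace.Core ℂ T.domain where
  inner u v := inner ℂ (u : E) (T v)
  conj_inner_symm u v := (h.inner_comm v u).symm
  re_inner_nonneg u := h.nonneg u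
  add_left _ _ _ := inner_add_left _ _ _
  smul_left _ _ _ := inner_smul_left _ _ _

/-- Cauchy–Schwarz for the semidefinite product `formCore`. -/
theorem IsNonnegSymmetric.norm_inner_sq_le (h : T.IsNonnegSymmetric) (u v : T.domain) :
    ‖inner ℂ (u : E) (T v)‖ ^ 2 ≤ T.form u * T.form v := by
  have := @InnerProductSpace.Core.inner_mul_inner_self_le ℂ T.domain _ _ _ (formCore h) u v
  have e : ‖inner ℂ (v : E) (T u)‖ = ‖inner ℂ (u : E) (T v)‖ := by
    rw [h.inner_comm u v, RCLike.norm_conj]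
  rw [pow_two]
  nth_rewrite 2 [← e]
  exact this

theorem form_add (h : T.IsNonnegSymmetric) (u v : T.domain) :
    T.form (u + v) = T.form u + T.form v + 2 * (inner ℂ (u : E) (T v)).re := by
  have := congrArg Complex.re (h.inner_comm u v)
  simp only [form, LinearPMap.map_add, Submodule.coe_add, inner_add_left, inner_add_right,
    Complex.add_re, Complex.conj_re] at this ⊢
  linarith

theorem subset_formDomain (h : T.IsNonnegSymmetric) : T.domain ≤ T.formDomain h := fun u hu =>
  ⟨fun _ => ⟨u, hu⟩, tendsto_const_nhds, by simp [form]⟩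

/-- The pairings `⟨u, T vₙ⟩ = ⟨T* u, vₙ⟩` converge to the claimed limit, and the error `⟨u - vₙ, T
vₙ⟩` is a limit over `m` of `⟨vₘ - vₙ, T vₙ⟩`. Cauchy–Schwarz for the form makes it small, since
`q[vₙ]` stays bounded while `q[vₘ - vₙ]` tends to zero. -/
theorem form_tendsto [CompleteSpace E] (h : T.IsNonnegSymmetric) {u : T.adjoint.domain}
    {v : ℕ → T.domain} (hv : Tendsto (fun n => (v n : E)) atTop (𝓝 (u : E)))
    (hq : Tendsto (fun p : ℕ × ℕ => T.form (v p.1 - v p.2)) atTop (𝓝 0)) :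
    Tendsto (fun n => (T.form (v n) : ℂ)) atTop (𝓝 (inner ℂ (T.adjoint u) (u : E))) := by
  have hlim : Tendsto (fun n => inner ℂ (u : E) (T (v n))) atTop
      (𝓝 (inner ℂ (T.adjoint u) (u : E))) := by
    refine (tendsto_const_nhds.inner hv).congr fun n => ?_
    exact adjoint_isFormalAdjoint h.dense u (v n)
  obtain ⟨N, hN⟩ : ∃ N, ∀ n ≥ N, ∀ m ≥ N, T.form (v n - v m) < 1 := by
    have := (hq.eventually (gt_mem_nhds one_pos))
    rw [eventually_atTop] at this
    obtain ⟨⟨a, b⟩, hab⟩ := this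
    exact ⟨max a b, fun n hn m hm => hab (n, m) ⟨le_trans (le_max_left _ _) hn,
      le_trans (le_max_right _ _) hm⟩⟩
  set C := 2 * T.form (v N) + 2
  have hC : ∀ n ≥ N, T.form (v n) ≤ C := fun n hn => by
    have h1 := form_add_le h (v n - v N) (v N)
    rw [sub_add_cancel] at h1
    have := hN n hn N le_rfl
    simp only [C]; linarith
  have hC0 : 0 ≤ C := (h.nonneg _).trans (hC N le_rfl)
  have hdiff : Tendsto (fun n => inner ℂ (u : E) (T (v n)) - (T.form (v n) : ℂ)) atTop (𝓝 0) := by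
    rw [Metric.tendsto_atTop]
    intro ε hε
    -- Chosen so that `q[vₘ - vₙ] q[vₙ] ≤ (ε / 2) ^ 2`; the `+ 1` guards against `C = 0`.
    have hδ : (0 : ℝ) < (ε / 2) ^ 2 / (C + 1) := by positivity
    have := (hq.eventually (gt_mem_nhds hδ))
    rw [eventually_atTop] at this
    obtain ⟨⟨a, b⟩, hab⟩ := this
    refine ⟨max N b, fun n hn => ?_⟩
    have hl : Tendsto (fun m => ‖inner ℂ ((v m - v n : T.domain) : E) (T (v n))‖) atTop
        (𝓝 ‖inner ℂ ((u : E) - v n) (T (v n))‖) :=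
      ((hv.sub_const (v n : E)).inner tendsto_const_nhds).norm
    have hle : ‖inner ℂ ((u : E) - v n) (T (v n))‖ ≤ ε / 2 := by
      refine le_of_tendsto hl (eventually_atTop.2 ⟨a, fun m hm => ?_⟩)
      have h1 := h.norm_inner_sq_le (v m - v n) (v n)
      have h2 := hab (m, n) ⟨hm, (le_max_right _ _).trans hn⟩
      have h3 := hC n ((le_max_left _ _).trans hn)
      refine abs_le_of_sq_le_sq' (h1.trans ?_) (by positivity) |>.2
      calc _ ≤ (ε / 2) ^ 2 / (C + 1) * (C + 1) :=
            mul_le_mul h2.le (h3.trans (by linarith)) (h.nonneg _) hδ.le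
        _ = _ := by field_simp
    rw [dist_zero_right, ← h.inner_self, ← inner_sub_left]
    linarith
  simpa using hlim.sub hdiff

theorem friedrichs_apply [CompleteSpace E] (h : T.IsNonnegSymmetric)
    (u : (T.friedrichs h).domain) : T.friedrichs h u = T.adjoint ⟨u, u.2.2⟩ :=
  domRestrict_apply rfl

theorem friedrichs_inner_nonneg [CompleteSpace E] (h : T.IsNonnegSymmetric)
    (u : (T.friedrichs h).domain) :
    ∃ r : ℝ, 0 ≤ r ∧ inner ℂ (T.friedrichs h u) (u : E) = r := by
  obtain ⟨v, hv, hq⟩ := u.2.1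
  have hl := form_tendsto h (u := ⟨u, u.2.2⟩) hv hq
  rw [← friedrichs_apply] at hl
  have hcl : _root_.IsClosed ((fun t : ℝ => (t : ℂ)) '' Ici 0) :=
    Complex.isometry_ofReal.isClosedEmbedding.isClosedMap _ isClosed_Ici
  obtain ⟨r, hr, e⟩ := hcl.mem_of_tendsto hl (Eventually.of_forall fun n => ⟨_, h.nonneg _, rfl⟩)
  exact ⟨r, hr, e.symm⟩

/-- Polarization: an operator with real quadratic form is symmetric. -/
theorem isFormalAdjoint_of_inner_self_real
    (hT : ∀ u : T.domain, ∃ r : ℝ, inner ℂ (T u) (u : E) = r) : T.IsFormalAdjoint T := by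
  have h0 : ∀ u : T.domain, inner ℂ (T u) (u : E) - inner ℂ (u : E) (T u) = 0 := fun u => by
    obtain ⟨r, hr⟩ := hT u
    rw [← inner_conj_symm (u : E), hr, Complex.conj_ofReal, sub_self]
  intro x y
  have h1 := h0 (x + y)
  have h2 := h0 (x + Complex.I • y)
  have hx := h0 x
  have hy := h0 y
  simp only [LinearPMap.map_add, LinearPMap.map_smul, Submodule.coe_add, Submodule.coe_smul,
    inner_add_left, inner_add_right, inner_smul_left, inner_smul_right, Complex.conj_I] at h1 h2
  have hI := Complex.I_mul_I
  linear_combination (1 / 2 : ℂ) * h1 - Complex.I / 2 * h2 - (1 / 2 - Complex.I / 2) * hx -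
    (1 / 2 + Complex.I ^ 3 / 2) * hy + (1 / 2 : ℂ) * (inner ℂ (T x) (y : E) -
      inner ℂ (x : E) (T y) - inner ℂ (T y) (x : E) + inner ℂ (y : E) (T x)) * hI

theorem friedrichs_symmetric [CompleteSpace E] (h : T.IsNonnegSymmetric) :
    (T.friedrichs h).IsFormalAdjoint (T.friedrichs h) :=
  isFormalAdjoint_of_inner_self_real fun u =>
    let ⟨r, _, hr⟩ := friedrichs_inner_nonneg h u
    ⟨r, hr⟩

theorem le_friedrichs [CompleteSpace E] (h : T.IsNonnegSymmetric) : T ≤ T.friedrichs h := by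
  have hle := h.symmetric.le_adjoint h.dense
  refine ⟨fun u hu => ⟨subset_formDomain h hu, hle.1 hu⟩, fun u v huv => ?_⟩
  rw [friedrichs_apply]
  exact hle.2 huv

/-- The minimization of `q[v] + ‖v‖² - 2 Re ⟨f, v⟩` solves `(T + 1) u = f` weakly. -/
theorem exists_weak_solution [CompleteSpace E] (h : T.IsNonnegSymmetric) (f : E) :
    ∃ u ∈ T.formDomain h, ∀ w : T.domain, inner ℂ u (T w + (w : E)) = inner ℂ f (w : E) := by
  set J : T.domain → ℝ := fun v => T.form v + ‖(v : E)‖ ^ 2 - 2 * (inner ℂ f (v : E)).re with hJ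
  have hbdd : BddBelow (range J) := by
    refine ⟨-‖f‖ ^ 2, ?_⟩
    rintro _ ⟨v, rfl⟩
    have h1 := h.nonneg v
    have h2 := (Complex.re_le_norm _).trans (norm_inner_le_norm (𝕜 := ℂ) f (v : E))
    simp only [hJ]
    nlinarith [sq_nonneg (‖f‖ - ‖(v : E)‖)]
  set m := iInf J
  have hm : ∀ v, m ≤ J v := fun v => ciInf_le hbdd v
  have hex : ∀ n : ℕ, ∃ v, J v < m + 1 / ((n : ℝ) + 1) := fun n =>
    exists_lt_of_ciInf_lt (lt_add_of_pos_right m (by positivity))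
  choose v hv using hex
  have hε : Tendsto (fun n : ℕ => 1 / ((n : ℝ) + 1)) atTop (𝓝 0) :=
    tendsto_one_div_add_atTop_nhds_zero_nat
  have hJadd : ∀ a w : T.domain, J (a + w) = J a + (T.form w + ‖(w : E)‖ ^ 2) +
      2 * (inner ℂ (a : E) (T w + (w : E)) - inner ℂ f (w : E)).re := fun a w => by
    have e : ‖(a : E) + w‖ ^ 2 = ‖(a : E)‖ ^ 2 + ‖(w : E)‖ ^ 2 +
        2 * (inner ℂ (a : E) (w : E)).re := by
      rw [norm_add_sq (𝕜 := ℂ)]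
      simp only [RCLike.re_to_complex]
      ring
    simp only [hJ, form_add h, Submodule.coe_add, e, inner_add_right, Complex.add_re,
      Complex.sub_re]
    ring
  have hJsmul : ∀ (a w : T.domain) (t : ℝ), J (a + (t : ℂ) • w) = J a +
      t ^ 2 * (T.form w + ‖(w : E)‖ ^ 2) +
      2 * t * (inner ℂ (a : E) (T w + (w : E)) - inner ℂ f (w : E)).re := fun a w t => by
    rw [hJadd, form_smul, Submodule.coe_smul, norm_smul, LinearPMap.map_smul, ← smul_add,
      inner_smul_right, inner_smul_right, ← mul_sub, Complex.re_ofReal_mul, mul_pow,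
      Complex.norm_real, Real.norm_eq_abs, sq_abs]
    ring
  -- Parallelogram argument: `J` at the midpoint of `v n` and `v k` is the mean of the two values
  -- minus a quarter of the left-hand side, and it is still at least `m`.
  have hcauchy : ∀ n k, T.form (v n - v k) + ‖((v n - v k : T.domain) : E)‖ ^ 2 ≤
      2 * (1 / ((n : ℝ) + 1)) + 2 * (1 / ((k : ℝ) + 1)) := fun n k => by
    have h2 := hJsmul (v k) (v n - v k) (1 / 2)
    have h3 := hJadd (v k) (v n - v k)
    rw [add_sub_cancel] at h3
    have h4 := hm (v k + ((1 / 2 : ℝ) : ℂ) • (v n - v k))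
    have h5 := hv n
    have h6 := hv k
    linarith
  have hcs : CauchySeq (fun n => (v n : E)) := by
    refine Metric.cauchySeq_iff'.2 fun ε hεp => ?_
    have hε4 : (0 : ℝ) < ε ^ 2 / 4 := by positivity
    obtain ⟨N, hN⟩ := (hε.eventually (gt_mem_nhds hε4)).exists_forall_of_atTop
    refine ⟨N, fun n hn => ?_⟩
    have h1 := hcauchy n N
    have h2 := h.nonneg (v n - v N)
    have h3 := hN n hn
    have h4 := hN N le_rfl
    rw [dist_eq_norm]
    refine abs_lt_of_sq_lt_sq' ?_ hεp.le |>.2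
    have : ((v n - v N : T.domain) : E) = (v n : E) - v N := rfl
    rw [this] at h1
    linarith
  obtain ⟨u, hu⟩ := cauchySeq_tendsto_of_complete hcs
  refine ⟨u, ⟨v, hu, ?_⟩, fun w => ?_⟩
  · have hlim : Tendsto (fun p : ℕ × ℕ => 2 * (1 / ((p.1 : ℝ) + 1)) + 2 * (1 / ((p.2 : ℝ) + 1)))
        atTop (𝓝 0) := by
      rw [← prod_atTop_atTop_eq]
      simpa using ((hε.comp tendsto_fst).const_mul 2).add ((hε.comp tendsto_snd).const_mul 2)
    refine squeeze_zero (fun p => h.nonneg _) (fun p => ?_) hlim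
    exact (le_add_of_nonneg_right (sq_nonneg _)).trans (hcauchy p.1 p.2)
  · have key : ∀ w : T.domain, (inner ℂ u (T w + (w : E)) - inner ℂ f (w : E)).re = 0 := by
      intro w
      have hg : Tendsto (fun n => (inner ℂ (v n : E) (T w + (w : E)) - inner ℂ f (w : E)).re) atTop
          (𝓝 (inner ℂ u (T w + (w : E)) - inner ℂ f (w : E)).re) :=
        (Complex.continuous_re.tendsto _).comp ((hu.inner tendsto_const_nhds).sub_const _)
      -- For every real `t`, `J (v n + t w) ≥ m > J (v n) - 1 / (n + 1)`. The resulting quadratic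
      -- polynomial in `t` is nonnegative, so its discriminant is nonpositive.
      have hsq : ∀ n, (inner ℂ (v n : E) (T w + (w : E)) - inner ℂ f (w : E)).re ^ 2 ≤
          (T.form w + ‖(w : E)‖ ^ 2) * (1 / ((n : ℝ) + 1)) := fun n => by
        have hd := discrim_le_zero (a := T.form w + ‖(w : E)‖ ^ 2)
          (b := 2 * (inner ℂ (v n : E) (T w + (w : E)) - inner ℂ f (w : E)).re)
          (c := 1 / ((n : ℝ) + 1)) (fun t => by
            have h1 := hJsmul (v n) w t
            have h2 := hm (v n + (t : ℂ) • w)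
            have h3 := hv n
            linarith)
        rw [discrim] at hd
        linarith
      have h0 := squeeze_zero (fun n => sq_nonneg _) hsq
        (by simpa using hε.const_mul (T.form w + ‖(w : E)‖ ^ 2))
      have := tendsto_nhds_unique (hg.pow 2) h0
      exact pow_eq_zero_iff two_ne_zero |>.1 this
    have h1 := key w
    -- Replacing `w` by `i w` recovers the imaginary part.
    have h2 := key (Complex.I • w)
    rw [LinearPMap.map_smul, Submodule.coe_smul, ← smul_add, inner_smul_right, inner_smul_right,
      ← mul_sub, Complex.I_mul_re, neg_eq_zero] at h2
    exact sub_eq_zero.1 (Complex.ext h1 h2)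

/-- The weak equation says precisely that `T* u` exists and equals `f - u`. -/
theorem friedrichs_add_one_surjective [CompleteSpace E] (h : T.IsNonnegSymmetric) (f : E) :
    ∃ u : (T.friedrichs h).domain, T.friedrichs h u + (u : E) = f := by
  obtain ⟨u, hu, hw⟩ := exists_weak_solution h f
  have hadj : ∀ w : T.domain, inner ℂ (f - u) (w : E) = inner ℂ u (T w) := fun w => by
    have := hw w
    rw [inner_add_right] at this
    rw [inner_sub_left, ← this]
    ring
  have hu' : u ∈ T.adjoint.domain := mem_adjoint_domain_of_exists u ⟨f - u, hadj⟩
  refine ⟨⟨u, hu, hu'⟩, ?_⟩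
  rw [friedrichs_apply, adjoint_apply_eq h.dense ⟨u, hu'⟩ hadj, sub_add_cancel]

/-- For `y` in the domain of `T*`, solve `(T + 1) w = (T* + 1) y` with `w` in the domain of `T`.
Then `y - w` is orthogonal to the range of `T + 1`, which is everything, so `y = w`. -/
theorem IsFormalAdjoint.isSelfAdjoint_of_surjective [CompleteSpace E]
    (hd : Dense (T.domain : Set E)) (hs : T.IsFormalAdjoint T) (hsurj : ∀ f : E, ∃ u : T.domain, T u + (u : E) = f) :
    IsSelfAdjoint T := by
  have hle := hs.le_adjoint hd
  refine isSelfAdjoint_def.2 (le_antisymm ?_ hle)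
  have hw : ∀ y : T.adjoint.domain, ∃ w : T.domain, (w : E) = y ∧ T w = T.adjoint y := by
    intro y
    obtain ⟨w, hw⟩ := hsurj (T.adjoint y + y)
    have h0 : (y : E) - w = 0 := by
      obtain ⟨x, hx⟩ := hsurj ((y : E) - w)
      rw [← inner_self_eq_zero (𝕜 := ℂ)]
      nth_rewrite 2 [← hx]
      have e1 := adjoint_isFormalAdjoint hd y x
      have e2 := hs w x
      have e3 := congrArg (fun z => inner ℂ z (x : E)) hw
      simp only [inner_add_left] at e3
      rw [inner_add_right, inner_sub_left, inner_sub_left, ← e1, ← e2]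
      linear_combination -e3
    have hyw : (w : E) = y := (sub_eq_zero.1 h0).symm
    refine ⟨w, hyw, ?_⟩
    rw [hyw] at hw
    exact add_right_cancel hw
  refine ⟨fun y hy => ?_, fun y x hyx => ?_⟩
  · obtain ⟨w, hw, -⟩ := hw ⟨y, hy⟩
    have : (w : E) = y := hw
    exact this ▸ w.2
  · obtain ⟨w, hw, hw'⟩ := hw y
    have : w = x := Subtype.ext (hw.trans hyx)
    rw [← hw', this]

theorem friedrichs_dense [CompleteSpace E] (h : T.IsNonnegSymmetric) :
    Dense ((T.friedrichs h).domain : Set E) :=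
  h.dense.mono (le_friedrichs h).1

theorem friedrichs_isSelfAdjoint [CompleteSpace E] (h : T.IsNonnegSymmetric) :
    IsSelfAdjoint (T.friedrichs h) :=
  (friedrichs_symmetric h).isSelfAdjoint_of_surjective (friedrichs_dense h)
    (friedrichs_add_one_surjective h)

/-! ### The spectrum of nonnegative self-adjoint operators -/

/-- The Rayleigh quotient of `u` is some `t ≥ 0`, so `⟨u, (T - z) u⟩` has modulus `‖u‖² |t - z|`, at
least `d ‖u‖²`. -/
theorem mul_norm_le_of_dist_le (hT : ∀ u : T.domain, ∃ r : ℝ, 0 ≤ r ∧ inner ℂ (T u) (u : E) = r)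
    {z : ℂ} {d : ℝ} (hd : ∀ t : ℝ, 0 ≤ t → d ≤ ‖(t : ℂ) - z‖) (u : T.domain) :
    d * ‖(u : E)‖ ≤ ‖T u - z • (u : E)‖ := by
  rcases eq_or_ne (u : E) 0 with h0 | h0
  · simp [h0]
  have hpos : 0 < ‖(u : E)‖ := norm_pos_iff.2 h0
  obtain ⟨r, hr, e⟩ := hT u
  have e' : inner ℂ (u : E) (T u - z • (u : E)) =
      ((‖(u : E)‖ ^ 2 : ℝ) : ℂ) * (((r / ‖(u : E)‖ ^ 2 : ℝ) : ℂ) - z) := by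
    rw [inner_sub_right, inner_smul_right, inner_self_eq_norm_sq_to_K, ← inner_conj_symm, e,
      Complex.conj_ofReal, mul_sub, ← Complex.ofReal_mul, mul_div_cancel₀ _ (by positivity)]
    push_cast
    simp [mul_comm]
  have h1 := norm_inner_le_norm (𝕜 := ℂ) (u : E) (T u - z • (u : E))
  rw [e', norm_mul, Complex.norm_real, Real.norm_of_nonneg (by positivity)] at h1
  have h2 := hd (r / ‖(u : E)‖ ^ 2) (by positivity)
  refine le_of_mul_le_mul_left ?_ hpos
  calc _ = ‖(u : E)‖ ^ 2 * d := by ring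
    _ ≤ _ := mul_le_mul_of_nonneg_left h2 (by positivity)
    _ ≤ _ := h1

/-- The lower bound at `z` gives injectivity and, with the closed graph of `T`, closed range. A
vector orthogonal to the range lies in the kernel of `T* - conj z = T - conj z`, which is trivial by
the same bound at `conj z`. The inverse has norm at most `d⁻¹`. -/
theorem _root_.IsSelfAdjoint.isResolventPoint_of_dist [CompleteSpace E] (hsa : IsSelfAdjoint T)
    (hT : ∀ u : T.domain, ∃ r : ℝ, 0 ≤ r ∧ inner ℂ (T u) (u : E) = r)
    {z : ℂ} {d : ℝ} (hd0 : 0 < d) (hd : ∀ t : ℝ, 0 ≤ t → d ≤ ‖(t : ℂ) - z‖) :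
    T.IsResolventPoint z := by
  have hb := mul_norm_le_of_dist_le hT hd
  have hb' := mul_norm_le_of_dist_le hT (z := conj z) (d := d) (fun t ht => by
    refine (hd t ht).trans_eq ?_
    rw [← RCLike.norm_conj (_ - z), _root_.map_sub, Complex.conj_ofReal])
  set L : T.domain →ₗ[ℂ] E := T.toFun - z • T.domain.subtype with hL
  have hLa : ∀ u, L u = T u - z • (u : E) := fun u => rfl
  have hinj : Function.Injective L := by
    refine (injective_iff_map_eq_zero L).2 fun u hu => ?_
    have := hb u
    rw [← hLa, hu, norm_zero] at this
    have h0 : ‖(u : E)‖ ≤ 0 := nonpos_of_mul_nonpos_right this hd0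
    exact Subtype.ext (norm_le_zero_iff.1 h0)
  have hclosed : _root_.IsClosed (LinearMap.range L : Set E) := by
    refine IsSeqClosed.isClosed fun f g hf hfg => ?_
    choose u hu using hf
    have hcs : CauchySeq (fun n => (u n : E)) := by
      refine Metric.cauchySeq_iff'.2 fun ε hε => ?_
      obtain ⟨N, hN⟩ := Metric.cauchySeq_iff'.1 hfg.cauchySeq (d * ε) (by positivity)
      refine ⟨N, fun n hn => ?_⟩
      have h1 := hb (u n - u N)
      have h2 := hN n hn
      rw [← hLa, _root_.map_sub, hu, hu] at h1
      rw [dist_eq_norm] at h2 ⊢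
      exact lt_of_mul_lt_mul_left (h1.trans_lt h2) hd0.le
    obtain ⟨x, hx⟩ := cauchySeq_tendsto_of_complete hcs
    have hTu : Tendsto (fun n => T (u n)) atTop (𝓝 (g + z • x)) := by
      refine (hfg.add (hx.const_smul z)).congr fun n => ?_
      rw [← hu, hLa, sub_add_cancel]
    have hmem : (x, g + z • x) ∈ T.graph := by
      refine hsa.isClosed.mem_of_tendsto (hx.prodMk_nhds hTu) (Eventually.of_forall fun n => ?_)
      exact T.mem_graph (u n)
    obtain ⟨y, hy1, hy2⟩ := (mem_graph_iff T).1 hmem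
    refine ⟨y, ?_⟩
    rw [hLa, hy2, hy1]
    simp
  have hrange : LinearMap.range L = ⊤ := by
    have : CompleteSpace (LinearMap.range L) := hclosed.completeSpace_coe
    rw [← Submodule.orthogonal_eq_bot_iff, Submodule.eq_bot_iff]
    intro y hy
    rw [Submodule.mem_orthogonal'] at hy
    have hy1 : ∀ x : T.domain, inner ℂ (conj z • y) (x : E) = inner ℂ y (T x) := fun x => by
      have := hy (L x) ⟨x, rfl⟩
      rw [hLa, inner_sub_right, inner_smul_right, sub_eq_zero] at this
      rw [inner_smul_left, this, Complex.conj_conj]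
    have hmem : y ∈ T.adjoint.domain := mem_adjoint_domain_of_exists y ⟨_, hy1⟩
    have happ := adjoint_apply_eq hsa.dense_domain ⟨y, hmem⟩ hy1
    have hle : T.adjoint ≤ T := (isSelfAdjoint_def.1 hsa).le
    have h2 := hle.2 (x := ⟨y, hmem⟩) (y := ⟨y, hle.1 hmem⟩) rfl
    rw [happ] at h2
    have h3 := hb' ⟨y, hle.1 hmem⟩
    rw [← h2, sub_self, norm_zero] at h3
    exact norm_le_zero_iff.1 (nonpos_of_mul_nonpos_right h3 hd0)
  set e := LinearEquiv.ofBijective L ⟨hinj, LinearMap.range_eq_top.1 hrange⟩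
  have he : ∀ f, L (e.symm f) = f := fun f => e.apply_symm_apply f
  refine ⟨LinearMap.mkContinuous (T.domain.subtype.comp e.symm.toLinearMap) d⁻¹ fun f => ?_,
    fun f => ⟨e.symm f, rfl, he f⟩, fun u => ?_⟩
  · have := hb (e.symm f)
    rw [← hLa, he] at this
    rw [inv_mul_eq_div, le_div_iff₀' hd0]
    exact this
  · rw [← hLa]
    exact congrArg Subtype.val (e.symm_apply_apply u)

theorem _root_.IsSelfAdjoint.spectrumSet_subset [CompleteSpace E] (hsa : IsSelfAdjoint T)
    (hT : ∀ u : T.domain, ∃ r : ℝ, 0 ≤ r ∧ inner ℂ (T u) (u : E) = r) :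
    T.spectrumSet ⊆ (fun t : ℝ => (t : ℂ)) '' Ici 0 := by
  intro z hz
  by_contra hzn
  have hcl : _root_.IsClosed ((fun t : ℝ => (t : ℂ)) '' Ici 0) :=
    Complex.isometry_ofReal.isClosedEmbedding.isClosedMap _ isClosed_Ici
  obtain ⟨d, hd, hball⟩ := Metric.isOpen_iff.1 hcl.isOpen_compl z hzn
  refine hz (hsa.isResolventPoint_of_dist hT hd fun t ht => ?_)
  by_contra! hlt
  refine hball (a := (t : ℂ)) ?_ ⟨t, ht, rfl⟩
  rwa [Metric.mem_ball, dist_eq_norm]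

/-- Weyl's criterion. -/
theorem mem_spectrumSet_of_approx {z : ℂ}
    (h : ∀ ε > 0, ∃ u : T.domain, ‖T u - z • (u : E)‖ < ε * ‖(u : E)‖) : z ∈ T.spectrumSet := by
  rintro ⟨R, -, hR⟩
  obtain ⟨u, hu⟩ := h (‖R‖ + 1)⁻¹ (by positivity)
  have h1 := R.le_opNorm (T u - z • (u : E))
  rw [hR u] at h1
  rw [inv_mul_eq_div, lt_div_iff₀ (by positivity)] at hu
  nlinarith [norm_nonneg (T u - z • (u : E))]

/-- A half-line has no isolated points, so the discrete spectrum is empty. -/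
theorem essentialSpectrum_eq_of_spectrumSet_eq
    (h : T.spectrumSet = (fun t : ℝ => (t : ℂ)) '' Ici 0) :
    T.essentialSpectrum = (fun t : ℝ => (t : ℂ)) '' Ici 0 := by
  rw [essentialSpectrum, h, sdiff_eq_left]
  refine Set.disjoint_left.2 ?_
  rintro _ ⟨t, ht, rfl⟩ ⟨-, ⟨ε, hε, hiso⟩, -⟩
  rw [mem_Ici] at ht
  have hmem : ((t + ε / 2 : ℝ) : ℂ) ∈ T.spectrumSet := by
    rw [h]
    exact ⟨_, add_nonneg ht (by positivity), rfl⟩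
  have := hiso _ hmem (by
    rw [Complex.isometry_ofReal.dist_eq, Real.dist_eq, add_sub_cancel_left,
      abs_of_pos (by positivity)]
    linarith)
  have := Complex.ofReal_injective this
  linarith

end Abstract

end LinearPMap

namespace SmilanskySolomyak

/-! ### Integration by parts on the plane cut along the line `x = 0` -/

/-- Because `g` vanishes for `|y| ≥ R`, the horizontal sides carry no flux. Differentiability is
needed only inside the slab and continuity up to its boundary, so the box may touch the singular
line. -/
theorem setIntegral_divergence_box {f g : ℝ × ℝ → ℂ} {a b R : ℝ} (hab : a ≤ b) (hR : 0 ≤ R)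
    (hf : ContinuousOn f (Icc a b ×ˢ univ)) (hg : ContinuousOn g (Icc a b ×ˢ univ))
    (hf' : ∀ p : ℝ × ℝ, p.1 ∈ Ioo a b → DifferentiableAt ℝ f p)
    (hg' : ∀ p : ℝ × ℝ, p.1 ∈ Ioo a b → DifferentiableAt ℝ g p)
    (hg0 : ∀ p : ℝ × ℝ, R ≤ |p.2| → g p = 0)
    (hi : IntegrableOn (fun p => fderiv ℝ f p (1, 0) + fderiv ℝ g p (0, 1))
      (Icc a b ×ˢ Icc (-R) R)) :
    ∫ p in Icc a b ×ˢ Icc (-R) R, (fderiv ℝ f p (1, 0) + fderiv ℝ g p (0, 1)) =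
      (∫ y in (-R)..R, f (b, y)) - ∫ y in (-R)..R, f (a, y) := by
  have hRR : -R ≤ R := by linarith
  have h := integral2_divergence_prod_of_hasFDerivAt f g (fderiv ℝ f) (fderiv ℝ g) a (-R) b R
    (hf.mono (prod_mono (by rw [uIcc_of_le hab]) (subset_univ _)))
    (hg.mono (prod_mono (by rw [uIcc_of_le hab]) (subset_univ _)))
    (fun p hp => (hf' p (by simpa [min_eq_left hab, max_eq_right hab] using hp.1)).hasFDerivAt)
    (fun p hp => (hg' p (by simpa [min_eq_left hab, max_eq_right hab] using hp.1)).hasFDerivAt)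
    (by rwa [uIcc_of_le hab, uIcc_of_le hRR])
  have h1 : ∀ x, g (x, R) = 0 := fun x => hg0 _ (le_abs_self _)
  have h2 : ∀ x, g (x, -R) = 0 := fun x => hg0 _ (by rw [abs_neg]; exact le_abs_self _)
  simp only [h1, h2, intervalIntegral.integral_zero, sub_self, zero_add] at h
  rw [← h, intervalIntegral.integral_of_le hab, Measure.volume_eq_prod, setIntegral_prod _
    (by rwa [← Measure.volume_eq_prod]), integral_Icc_eq_integral_Ioc]
  simp_rw [intervalIntegral.integral_of_le hRR, integral_Icc_eq_integral_Ioc]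

/-- The divergence theorem for a compactly supported vector field which is smooth off the line
`x = 0` and whose normal component is continuous across this line. -/
theorem integral_divergence_eq_zero {f g fr gr fl gl : ℝ × ℝ → ℂ} {R : ℝ} (hR : 0 ≤ R)
    (hfr : ContinuousOn fr {p | 0 ≤ p.1}) (hgr : ContinuousOn gr {p | 0 ≤ p.1})
    (hfl : ContinuousOn fl {p | p.1 ≤ 0}) (hgl : ContinuousOn gl {p | p.1 ≤ 0})
    (efr : ∀ p : ℝ × ℝ, 0 < p.1 → fr p = f p) (egr : ∀ p : ℝ × ℝ, 0 < p.1 → gr p = g p)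
    (efl : ∀ p : ℝ × ℝ, p.1 < 0 → fl p = f p) (egl : ∀ p : ℝ × ℝ, p.1 < 0 → gl p = g p)
    (hfd : ∀ p : ℝ × ℝ, p.1 ≠ 0 → DifferentiableAt ℝ f p)
    (hgd : ∀ p : ℝ × ℝ, p.1 ≠ 0 → DifferentiableAt ℝ g p)
    (h0 : ∀ y, fr (0, y) = fl (0, y))
    (sf : ∀ p : ℝ × ℝ, R ≤ ‖p‖ → f p = 0) (sg : ∀ p : ℝ × ℝ, R ≤ ‖p‖ → g p = 0)
    (sfr : ∀ p : ℝ × ℝ, R ≤ ‖p‖ → fr p = 0) (sgr : ∀ p : ℝ × ℝ, R ≤ ‖p‖ → gr p = 0)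
    (sfl : ∀ p : ℝ × ℝ, R ≤ ‖p‖ → fl p = 0) (sgl : ∀ p : ℝ × ℝ, R ≤ ‖p‖ → gl p = 0)
    (hi : Integrable (fun p => fderiv ℝ f p (1, 0) + fderiv ℝ g p (0, 1))) :
    ∫ p, (fderiv ℝ f p (1, 0) + fderiv ℝ g p (0, 1)) = 0 := by
  set d := fun p => fderiv ℝ f p (1, 0) + fderiv ℝ g p (0, 1) with hd
  have hRR : -R ≤ R := by linarith
  have er : ∀ p : ℝ × ℝ, 0 < p.1 → fr =ᶠ[𝓝 p] f ∧ gr =ᶠ[𝓝 p] g := fun p hp => by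
    have hn : {q : ℝ × ℝ | 0 < q.1} ∈ 𝓝 p := (isOpen_lt continuous_const continuous_fst).mem_nhds hp
    exact ⟨mem_of_superset hn efr, mem_of_superset hn egr⟩
  have el : ∀ p : ℝ × ℝ, p.1 < 0 → fl =ᶠ[𝓝 p] f ∧ gl =ᶠ[𝓝 p] g := fun p hp => by
    have hn : {q : ℝ × ℝ | q.1 < 0} ∈ 𝓝 p := (isOpen_lt continuous_fst continuous_const).mem_nhds hp
    exact ⟨mem_of_superset hn efl, mem_of_superset hn egl⟩
  have snorm : ∀ p : ℝ × ℝ, R ≤ |p.2| → R ≤ ‖p‖ := fun p hp => hp.trans (norm_snd_le p)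
  have dr : (fun p => fderiv ℝ fr p (1, 0) + fderiv ℝ gr p (0, 1)) =ᵐ[volume.restrict
      (Icc 0 R ×ˢ Icc (-R) R)] d := by
    filter_upwards [ae_restrict_of_ae ae_fst_ne_zero,
      ae_restrict_mem (measurableSet_Icc.prod measurableSet_Icc)] with p hp hp'
    have := er p (lt_of_le_of_ne hp'.1.1 (Ne.symm hp))
    rw [hd, this.1.fderiv_eq, this.2.fderiv_eq]
  have dl : (fun p => fderiv ℝ fl p (1, 0) + fderiv ℝ gl p (0, 1)) =ᵐ[volume.restrict
      (Icc (-R) 0 ×ˢ Icc (-R) R)] d := by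
    filter_upwards [ae_restrict_of_ae ae_fst_ne_zero,
      ae_restrict_mem (measurableSet_Icc.prod measurableSet_Icc)] with p hp hp'
    have := el p (lt_of_le_of_ne hp'.1.2 hp)
    rw [hd, this.1.fderiv_eq, this.2.fderiv_eq]
  have hr := setIntegral_divergence_box (f := fr) (g := gr) hR hR
    (hfr.mono fun p hp => hp.1.1) (hgr.mono fun p hp => hp.1.1)
    (fun p hp => (hfd p hp.1.ne').congr_of_eventuallyEq (er p hp.1).1)
    (fun p hp => (hgd p hp.1.ne').congr_of_eventuallyEq (er p hp.1).2)
    (fun p hp => sgr p (snorm p hp)) (hi.integrableOn.congr dr.symm)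
  have hl := setIntegral_divergence_box (f := fl) (g := gl) (neg_nonpos.2 hR) hR
    (hfl.mono fun p hp => hp.1.2) (hgl.mono fun p hp => hp.1.2)
    (fun p hp => (hfd p hp.2.ne).congr_of_eventuallyEq (el p hp.2).1)
    (fun p hp => (hgd p hp.2.ne).congr_of_eventuallyEq (el p hp.2).2)
    (fun p hp => sgl p (snorm p hp)) (hi.integrableOn.congr dl.symm)
  rw [integral_congr_ae dr] at hr
  rw [integral_congr_ae dl] at hl
  have hr0 : ∀ y, fr (R, y) = 0 := fun y => sfr _ ((le_abs_self R).trans (norm_fst_le (R, y)))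
  have hl0 : ∀ y, fl (-R, y) = 0 := fun y =>
    sfl _ (((le_abs_self R).trans_eq (abs_neg R).symm).trans (norm_fst_le (-R, y)))
  -- The outer fluxes vanish by the support condition; by `h0` the two fluxes through `x = 0` become
  -- the same integral with opposite signs.
  simp only [hr0, hl0, h0, intervalIntegral.integral_zero] at hr hl
  have hunion : (∫ p, d p) = ∫ p in (Icc 0 R ×ˢ Icc (-R) R) ∪ (Icc (-R) 0 ×ˢ Icc (-R) R), d p := by
    refine (setIntegral_eq_integral_of_forall_compl_eq_zero fun p hp => ?_).symm
    have hlt : R < ‖p‖ := by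
      by_contra! hle
      refine hp ?_
      rw [Prod.norm_def, max_le_iff, Real.norm_eq_abs, Real.norm_eq_abs, abs_le, abs_le] at hle
      rcases le_total 0 p.1 with h | h
      · exact Or.inl ⟨⟨h, hle.1.2⟩, hle.2⟩
      · exact Or.inr ⟨⟨hle.1.1, h⟩, hle.2⟩
    have hn : {q : ℝ × ℝ | R < ‖q‖} ∈ 𝓝 p := (isOpen_lt continuous_const continuous_norm).mem_nhds hlt
    have e1 : f =ᶠ[𝓝 p] fun _ => 0 := mem_of_superset hn fun q hq => sf q (le_of_lt hq)
    have e2 : g =ᶠ[𝓝 p] fun _ => 0 := mem_of_superset hn fun q hq => sg q (le_of_lt hq)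
    simp [hd, e1.fderiv_eq, e2.fderiv_eq]
  rw [hunion, setIntegral_union₀ _ (measurableSet_Icc.prod measurableSet_Icc).nullMeasurableSet
    hi.integrableOn hi.integrableOn, hr, hl]
  · ring
  · refine measure_mono_null (t := {p : ℝ × ℝ | ¬ p.1 ≠ 0}) (fun p hp => ?_) ae_fst_ne_zero
    exact not_not.2 (le_antisymm hp.2.1.2 hp.1.1.1)

/-! ### Leibniz rule for momenta and factorization of the Hamiltonian -/

/-- The potential `a` is real, so its contributions to the two momentum terms cancel. This is the
pointwise form of the symmetry of `i ∂ₑ + a`, with `η` as cut-off. -/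
theorem fderiv_mul_conj_mul {a : ℝ × ℝ → ℝ} {e p : ℝ × ℝ} {η w G : ℝ × ℝ → ℂ}
    (hη : DifferentiableAt ℝ η p) (hw : DifferentiableAt ℝ w p) (hG : DifferentiableAt ℝ G p) :
    fderiv ℝ (fun q => η q * (conj (w q) * G q)) p e = fderiv ℝ η p e * (conj (w p) * G p) -
      Complex.I * η p * (conj (w p) * momentum a e G p - conj (momentum a e w p) * G p) := by
  have hc : HasFDerivAt (fun q => conj (w q))
      ((Complex.conjCLE : ℂ →L[ℝ] ℂ).comp (fderiv ℝ w p)) p :=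
    (Complex.conjCLE : ℂ →L[ℝ] ℂ).hasFDerivAt.comp p hw.hasFDerivAt
  rw [(hη.hasFDerivAt.fun_mul (hc.fun_mul hG.hasFDerivAt)).fderiv]
  simp only [momentum, _root_.add_apply, _root_.smul_apply, smul_eq_mul,
    ContinuousLinearMap.comp_apply, ContinuousLinearEquiv.coe_coe, Complex.conjCLE_apply, map_add,
    map_mul, Complex.conj_I, Complex.conj_ofReal]
  linear_combination (η p * conj (w p) * fderiv ℝ G p e + η p * conj (fderiv ℝ w p e) * G p) *
    Complex.I_mul_I

theorem momentum_snd_mul {a : ℝ × ℝ → ℝ} {p : ℝ × ℝ} {v : ℝ × ℝ → ℂ}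
    (hv : DifferentiableAt ℝ v p) :
    momentum a (1, 0) (fun q => (q.2 : ℂ) * v q) p = p.2 * momentum a (1, 0) v p := by
  have h2 : HasFDerivAt (fun q : ℝ × ℝ => (q.2 : ℂ))
      (Complex.ofRealCLM.comp (ContinuousLinearMap.snd ℝ ℝ ℝ)) p :=
    Complex.ofRealCLM.hasFDerivAt.comp p (ContinuousLinearMap.snd ℝ ℝ ℝ).hasFDerivAt
  rw [momentum, (h2.fun_mul hv.hasFDerivAt).fderiv, momentum]
  simp
  ring

variable {B : ℝ}

/-- The sign of `x`, with the value `-1` at `x = 0`. -/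
def sgn (x : ℝ) : ℝ := if 0 < x then 1 else -1

theorem abs_sgn (x : ℝ) : |sgn x| = 1 := by
  unfold sgn; split_ifs <;> simp

theorem sgn_mul_self (x : ℝ) : sgn x * sgn x = 1 := by
  unfold sgn; split_ifs <;> simp

theorem measurable_sgn : Measurable sgn :=
  Measurable.ite measurableSet_Ioi measurable_const measurable_const

theorem sgn_eventuallyEq {p : ℝ × ℝ} (hp : p.1 ≠ 0) :
    ∀ᶠ q : ℝ × ℝ in 𝓝 p, sgn q.1 = sgn p.1 := by
  rcases lt_or_gt_of_ne hp with h | h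
  · filter_upwards [(isOpen_lt continuous_fst continuous_const).mem_nhds h] with q hq
    simp [sgn, not_lt.2 h.le, not_lt.2 (le_of_lt hq)]
  · filter_upwards [(isOpen_lt continuous_const continuous_fst).mem_nhds h] with q hq
    have hq : 0 < q.1 := hq
    have h : 0 < p.1 := h
    simp [sgn, h, hq]

/-- The first order expression `D v = (i ∂ₓ + A₁) v + i ω y sgn(x) v`, for which
`(i ∂ₓ + A₁)² + ω² y² - 2 ω y δ(x) = D* D`. -/
def factorX (A : VectorPotential B) (ω : ℝ) (v : ℝ × ℝ → ℂ) (p : ℝ × ℝ) : ℂ :=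
  momentumX A v p + Complex.I * ω * sgn p.1 * (p.2 * v p)

theorem factorX_eventuallyEq (A : VectorPotential B) (ω : ℝ) (v : ℝ × ℝ → ℂ) {p : ℝ × ℝ}
    (hp : p.1 ≠ 0) : factorX A ω v =ᶠ[𝓝 p]
      fun q => momentumX A v q + Complex.I * ω * sgn p.1 * (q.2 * v q) := by
  filter_upwards [sgn_eventuallyEq hp] with q hq
  rw [factorX, hq]

theorem differentiableAt_snd_mul {p : ℝ × ℝ} {v : ℝ × ℝ → ℂ} (hv : DifferentiableAt ℝ v p) :
    DifferentiableAt ℝ (fun q => (q.2 : ℂ) * v q) p :=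
  (Complex.ofRealCLM.differentiableAt.comp p differentiableAt_snd).mul hv

section Green

variable {A : VectorPotential B} {ω lam : ℝ} {v w : ℝ × ℝ → ℂ}

theorem MemD0.differentiableAt (h : MemD0 A ω lam v) {p : ℝ × ℝ} (hp : p.1 ≠ 0) :
    DifferentiableAt ℝ v p := (h.contDiffAt hp).differentiableAt (by norm_num)

theorem MemD0.factorX_differentiableAt (h : MemD0 A ω lam v) {p : ℝ × ℝ} (hp : p.1 ≠ 0) :
    DifferentiableAt ℝ (factorX A ω v) p :=
  ((momentum_differentiableAt A.contDiff₁ (h.contDiffAt hp)).add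
    ((differentiableAt_snd_mul (h.differentiableAt hp)).const_mul _)).congr_of_eventuallyEq
    (factorX_eventuallyEq A ω v hp)

/-- Off the line `sgn` is locally constant, so `y sgn(x)` commutes with `i ∂ₓ + A₁`. The delta term
appears only through the traces on the line. -/
theorem MemD0.momentumX_factorX (h : MemD0 A ω lam v) {p : ℝ × ℝ} (hp : p.1 ≠ 0) :
    momentumX A (factorX A ω v) p = momentumX A (momentumX A v) p +
      Complex.I * ω * sgn p.1 * (p.2 * momentumX A v p) := by
  have e := factorX_eventuallyEq A ω v hp
  have h1 := momentum_lin (a := A.A₁) (e := (1, 0))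
    (momentum_differentiableAt A.contDiff₁ (e := (1, 0)) (h.contDiffAt hp))
    (differentiableAt_snd_mul (h.differentiableAt hp)) (Complex.I * ω * sgn p.1)
  rw [momentum_snd_mul (h.differentiableAt hp)] at h1
  rw [momentumX, momentum, e.fderiv_eq, e.eq_of_nhds]
  exact h1

/-- The divergence of the cut-off flux. -/
theorem MemD0.divergence (hv : MemD0 A ω lam v) (hw : MemD0 A ω lam w) {η : ℝ × ℝ → ℂ}
    {p : ℝ × ℝ} (hη : DifferentiableAt ℝ η p) (hp : p.1 ≠ 0) :
    fderiv ℝ (fun q => η q * (conj (w q) * factorX A ω v q)) p (1, 0) +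
      fderiv ℝ (fun q => η q * (conj (w q) * momentumY A v q)) p (0, 1) =
    fderiv ℝ η p (1, 0) * (conj (w p) * factorX A ω v p) +
      fderiv ℝ η p (0, 1) * (conj (w p) * momentumY A v p) -
      Complex.I * η p * (conj (w p) * hamiltonian A ω v p -
        conj (factorX A ω w p) * factorX A ω v p - conj (momentumY A w p) * momentumY A v p) := by
  unfold momentumY
  rw [fderiv_mul_conj_mul (a := A.A₁) hη (hw.differentiableAt hp) (hv.factorX_differentiableAt hp),
    fderiv_mul_conj_mul (a := A.A₂) hη (hw.differentiableAt hp)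
      (momentum_differentiableAt A.contDiff₂ (hv.contDiffAt hp))]
  have h1 := hv.momentumX_factorX hp
  -- This turns the square of the extra term `ω y sgn(x)` into the potential `ω² y²`.
  have hs : (sgn p.1 : ℂ) * sgn p.1 = 1 := by exact_mod_cast sgn_mul_self p.1
  simp only [hamiltonian]
  simp only [momentumX, momentumY] at h1 ⊢
  rw [h1]
  simp only [factorX, momentumX, map_add, map_mul, Complex.conj_I, Complex.conj_ofReal]
  push_cast
  have hI2 : Complex.I ^ 3 = -Complex.I := by rw [pow_succ, Complex.I_sq]; ring
  linear_combination (-(ω : ℂ) ^ 2 * p.2 ^ 2 * conj (w p) * v p * η p * Complex.I) * hs +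
    ((ω : ℂ) ^ 2 * p.2 ^ 2 * conj (w p) * v p * η p * sgn p.1 ^ 2) * hI2

end Green

/-! #### One-sided traces of the momenta -/

/-- The expression `(i ∂ₑ + a) v` formed with the derivative of `v` within a set. -/
def momentumWithin (s : Set (ℝ × ℝ)) (a : ℝ × ℝ → ℝ) (e : ℝ × ℝ) (v : ℝ × ℝ → ℂ) (p : ℝ × ℝ) : ℂ :=
  Complex.I * fderivWithin ℝ v s p e + (a p : ℂ) * v p

theorem uniqueDiffOn_right : UniqueDiffOn ℝ {p : ℝ × ℝ | 0 ≤ p.1} := by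
  have : {p : ℝ × ℝ | 0 ≤ p.1} = Ici (0 : ℝ) ×ˢ univ := by ext; simp
  rw [this]
  exact (uniqueDiffOn_Ici 0).prod uniqueDiffOn_univ

theorem uniqueDiffOn_left : UniqueDiffOn ℝ {p : ℝ × ℝ | p.1 ≤ 0} := by
  have : {p : ℝ × ℝ | p.1 ≤ 0} = Iic (0 : ℝ) ×ˢ univ := by ext; simp
  rw [this]
  exact (uniqueDiffOn_Iic 0).prod uniqueDiffOn_univ

theorem momentumWithin_continuousOn {s : Set (ℝ × ℝ)} (hs : UniqueDiffOn ℝ s) {a : ℝ × ℝ → ℝ}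
    (ha : Continuous a) {e : ℝ × ℝ} {v : ℝ × ℝ → ℂ} (hv : ContDiffOn ℝ 2 v s) :
    ContinuousOn (momentumWithin s a e v) s :=
  (continuousOn_const.mul ((hv.continuousOn_fderivWithin hs (by norm_num)).clm_apply
    continuousOn_const)).add
    ((Complex.continuous_ofReal.comp ha).continuousOn.mul hv.continuousOn)

theorem momentumWithin_of_mem_nhds {s : Set (ℝ × ℝ)} {a : ℝ × ℝ → ℝ} {e p : ℝ × ℝ}
    {v : ℝ × ℝ → ℂ} (hp : s ∈ 𝓝 p) : momentumWithin s a e v p = momentum a e v p := by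
  rw [momentumWithin, fderivWithin_of_mem_nhds hp, momentum]

theorem right_mem_nhds {p : ℝ × ℝ} (hp : 0 < p.1) : {p : ℝ × ℝ | 0 ≤ p.1} ∈ 𝓝 p :=
  mem_of_superset ((isOpen_lt continuous_const continuous_fst).mem_nhds hp) fun q hq =>
    le_of_lt (by simpa using hq)

theorem left_mem_nhds {p : ℝ × ℝ} (hp : p.1 < 0) : {p : ℝ × ℝ | p.1 ≤ 0} ∈ 𝓝 p :=
  mem_of_superset ((isOpen_lt continuous_fst continuous_const).mem_nhds hp) fun q hq =>
    le_of_lt (by simpa using hq)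

theorem derivWithin_fst_eq {s : Set (ℝ × ℝ)} {t : Set ℝ} {v : ℝ × ℝ → ℂ} {y : ℝ}
    (hv : DifferentiableWithinAt ℝ v s (0, y)) (hst : ∀ x ∈ t, (x, y) ∈ s)
    (ht : UniqueDiffWithinAt ℝ t 0) :
    derivWithin (fun x : ℝ => v (x, y)) t 0 = fderivWithin ℝ v s (0, y) (1, 0) := by
  have h1 : HasDerivWithinAt (fun x : ℝ => (x, y)) ((1 : ℝ), (0 : ℝ)) t 0 :=
    (hasDerivWithinAt_id _ _).prodMk (hasDerivWithinAt_const _ _ _)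
  have h2 := HasFDerivWithinAt.comp_hasDerivWithinAt (0 : ℝ) (f := fun x : ℝ => (x, y))
    hv.hasFDerivWithinAt h1 hst
  exact h2.derivWithin ht

/-! ### Green's identity for the factorized operator -/

section Green

variable {A : VectorPotential B} {ω lam : ℝ} {v w : ℝ × ℝ → ℂ}

/-- This is the matching condition multiplied by `i`: the jump `-2 ω y v` of the derivative
compensates the jump `2 i ω y v` of the term with `sgn`. Only here is the value of `lam` used in
Green's identity. -/
theorem MemD0.factorX_trace (hlam : lam = -2 * ω) (h : MemD0 A ω lam v) (y : ℝ) :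
    momentumWithin {p | 0 ≤ p.1} A.A₁ (1, 0) v (0, y) + Complex.I * ω * (y * v (0, y)) =
      momentumWithin {p | p.1 ≤ 0} A.A₁ (1, 0) v (0, y) - Complex.I * ω * (y * v (0, y)) := by
  have hj := h.jump y
  have hr : DifferentiableOn ℝ v {p | 0 ≤ p.1} := h.right.differentiableOn (by norm_num)
  have hl : DifferentiableOn ℝ v {p | p.1 ≤ 0} := h.left.differentiableOn (by norm_num)
  rw [derivWithin_fst_eq (hr (0, y) (by simp)) (fun x hx => by simpa using hx)
      (uniqueDiffOn_Ici 0 0 (by simp)),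
    derivWithin_fst_eq (hl (0, y) (by simp)) (fun x hx => by simpa using hx)
      (uniqueDiffOn_Iic 0 0 (by simp)), hlam] at hj
  simp only [momentumWithin]
  push_cast at hj
  linear_combination Complex.I * hj

theorem MemD0.memLp_factorX (h : MemD0 A ω lam v) : MemLp (factorX A ω v) 2 volume := by
  refine h.memLp_X.add ?_
  have h1 : MemLp (fun p : ℝ × ℝ => (sgn p.1 : ℂ) * ((p.2 : ℂ) * v p)) 2 volume := by
    refine h.memLp_y.of_le ?_ (Eventually.of_forall fun p => ?_)
    · exact (Complex.measurable_ofReal.comp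
        (measurable_sgn.comp measurable_fst)).aestronglyMeasurable.mul h.memLp_y.1
    · rw [norm_mul (sgn p.1 : ℂ), Complex.norm_real, Real.norm_eq_abs, abs_sgn, one_mul]
  refine (h1.const_mul (Complex.I * ω)).ae_eq (Eventually.of_forall fun p => ?_)
  simp only [mul_assoc]

theorem integrable_conj_mul {f g : ℝ × ℝ → ℂ} (hf : MemLp f 2 volume) (hg : MemLp g 2 volume) :
    Integrable (fun p => conj (f p) * g p) :=
  (hf.star : MemLp (star f) 2 volume).integrable_mul hg

/-- Green's identity tested with a cut-off function. -/
theorem MemD0.integral_cutoff (hlam : lam = -2 * ω) (hv : MemD0 A ω lam v) (hw : MemD0 A ω lam w)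
    {η : ℝ × ℝ → ℂ} (hη : ContDiff ℝ 1 η) {R C : ℝ} (hR : 0 ≤ R)
    (hs : ∀ p, R ≤ ‖p‖ → η p = 0) (hηC : ∀ p, ‖η p‖ ≤ C) (hηC' : ∀ p, ‖fderiv ℝ η p‖ ≤ C) :
    ∫ p, η p * (conj (w p) * hamiltonian A ω v p -
        conj (factorX A ω w p) * factorX A ω v p - conj (momentumY A w p) * momentumY A v p) =
      -Complex.I * ∫ p, (fderiv ℝ η p (1, 0) * (conj (w p) * factorX A ω v p) +
        fderiv ℝ η p (0, 1) * (conj (w p) * momentumY A v p)) := by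
  have hK : Integrable (fun p => conj (w p) * hamiltonian A ω v p -
        conj (factorX A ω w p) * factorX A ω v p - conj (momentumY A w p) * momentumY A v p) :=
    ((integrable_conj_mul hw.memLp hv.memLp_hamiltonian).sub
      (integrable_conj_mul hw.memLp_factorX hv.memLp_factorX)).sub
      (integrable_conj_mul hw.memLp_Y hv.memLp_Y)
  have hηd : Differentiable ℝ η := hη.differentiable (by norm_num)
  have hfd : ∀ e : ℝ × ℝ, ‖e‖ ≤ 1 → ∀ p, ‖fderiv ℝ η p e‖ ≤ C := fun e he p =>
    ((fderiv ℝ η p).le_opNorm e).trans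
      ((mul_le_of_le_one_right (norm_nonneg _) he).trans (hηC' p))
  have hfm : ∀ e : ℝ × ℝ, AEStronglyMeasurable (fun p => fderiv ℝ η p e) := fun e =>
    ((hη.continuous_fderiv (by norm_num)).clm_apply continuous_const).aestronglyMeasurable
  have hK' : Integrable (fun p => η p * (conj (w p) * hamiltonian A ω v p -
        conj (factorX A ω w p) * factorX A ω v p - conj (momentumY A w p) * momentumY A v p)) :=
    hK.bdd_mul hη.continuous.aestronglyMeasurable (Eventually.of_forall hηC)
  have hF1 : Integrable (fun p => fderiv ℝ η p (1, 0) * (conj (w p) * factorX A ω v p)) :=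
    (integrable_conj_mul hw.memLp hv.memLp_factorX).bdd_mul (hfm _)
      (Eventually.of_forall (hfd _ (by simp [Prod.norm_def])))
  have hF2 : Integrable (fun p => fderiv ℝ η p (0, 1) * (conj (w p) * momentumY A v p)) :=
    (integrable_conj_mul hw.memLp hv.memLp_Y).bdd_mul (hfm _)
      (Eventually.of_forall (hfd _ (by simp [Prod.norm_def])))
  have hdiv : (fun p => fderiv ℝ (fun q => η q * (conj (w q) * factorX A ω v q)) p (1, 0) +
      fderiv ℝ (fun q => η q * (conj (w q) * momentumY A v q)) p (0, 1)) =ᵐ[volume] fun p =>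
      (fderiv ℝ η p (1, 0) * (conj (w p) * factorX A ω v p) +
        fderiv ℝ η p (0, 1) * (conj (w p) * momentumY A v p)) -
      Complex.I * (η p * (conj (w p) * hamiltonian A ω v p -
        conj (factorX A ω w p) * factorX A ω v p - conj (momentumY A w p) * momentumY A v p)) := by
    filter_upwards [ae_fst_ne_zero] with p hp
    rw [hv.divergence hw (hηd p) hp]
    ring
  have hint := (hF1.add hF2).sub (hK'.const_mul Complex.I)
  have hz : ∀ {G : ℝ × ℝ → ℂ} (p : ℝ × ℝ), R ≤ ‖p‖ → η p * (conj (w p) * G p) = 0 :=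
    fun p hp => by rw [hs p hp, zero_mul]
  have hwc : ∀ s, ContinuousOn (fun q => conj (w q)) s := fun s =>
    (Complex.continuous_conj.comp hw.continuous).continuousOn
  have hyv : ∀ s, ContinuousOn (fun q : ℝ × ℝ => Complex.I * ω * ((q.2 : ℂ) * v q)) s := fun s =>
    (continuous_const.mul ((Complex.continuous_ofReal.comp continuous_snd).mul
      hv.continuous)).continuousOn
  have hX := A.contDiff₁.continuous
  have hY := A.contDiff₂.continuous
  have hwd : ∀ {p : ℝ × ℝ}, p.1 ≠ 0 → DifferentiableAt ℝ (fun q => conj (w q)) p := fun hp =>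
    (Complex.conjCLE : ℂ →L[ℝ] ℂ).differentiableAt.comp _ (hw.differentiableAt hp)
  -- The one-sided fields replace `sgn` by `±1` and `fderiv` by the derivative within the closed
  -- half-plane, which makes them continuous up to the line.
  have h0 := integral_divergence_eq_zero
    (f := fun q => η q * (conj (w q) * factorX A ω v q))
    (g := fun q => η q * (conj (w q) * momentumY A v q))
    (fr := fun q => η q * (conj (w q) *
      (momentumWithin {p | 0 ≤ p.1} A.A₁ (1, 0) v q + Complex.I * ω * (q.2 * v q))))
    (gr := fun q => η q * (conj (w q) * momentumWithin {p | 0 ≤ p.1} A.A₂ (0, 1) v q))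
    (fl := fun q => η q * (conj (w q) *
      (momentumWithin {p | p.1 ≤ 0} A.A₁ (1, 0) v q - Complex.I * ω * (q.2 * v q))))
    (gl := fun q => η q * (conj (w q) * momentumWithin {p | p.1 ≤ 0} A.A₂ (0, 1) v q))
    hR
    (hη.continuous.continuousOn.mul ((hwc _).mul
      ((momentumWithin_continuousOn uniqueDiffOn_right hX hv.right).add (hyv _))))
    (hη.continuous.continuousOn.mul ((hwc _).mul
      (momentumWithin_continuousOn uniqueDiffOn_right hY hv.right)))
    (hη.continuous.continuousOn.mul ((hwc _).mul
      ((momentumWithin_continuousOn uniqueDiffOn_left hX hv.left).sub (hyv _))))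
    (hη.continuous.continuousOn.mul ((hwc _).mul
      (momentumWithin_continuousOn uniqueDiffOn_left hY hv.left)))
    (fun p hp => by
      simp [momentumWithin_of_mem_nhds (right_mem_nhds hp), factorX, sgn, hp, momentumX])
    (fun p hp => by simp [momentumWithin_of_mem_nhds (right_mem_nhds hp), momentumY])
    (fun p hp => by
      simp [momentumWithin_of_mem_nhds (left_mem_nhds hp), factorX, sgn, not_lt.2 hp.le, momentumX,
        sub_eq_add_neg])
    (fun p hp => by simp [momentumWithin_of_mem_nhds (left_mem_nhds hp), momentumY])
    (fun p hp => (hηd p).mul ((hwd hp).mul (hv.factorX_differentiableAt hp)))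
    (fun p hp => (hηd p).mul ((hwd hp).mul
      (momentum_differentiableAt A.contDiff₂ (hv.contDiffAt hp))))
    (fun y => by simp only [hv.factorX_trace hlam y])
    hz hz hz hz hz hz (hint.congr hdiv.symm)
  have hF : Integrable (fun p => fderiv ℝ η p (1, 0) * (conj (w p) * factorX A ω v p) +
      fderiv ℝ η p (0, 1) * (conj (w p) * momentumY A v p)) := hF1.add hF2
  rw [integral_congr_ae hdiv, integral_sub hF (hK'.const_mul _),
    integral_const_mul, sub_eq_zero] at h0
  rw [h0, ← mul_assoc, neg_mul, Complex.I_mul_I, neg_neg, one_mul]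

end Green

/-- Cut-off functions exhausting the plane, with gradients tending to zero. -/
theorem exists_cutoff_sequence : ∃ (η : ℕ → ℝ × ℝ → ℂ) (C : ℝ), (∀ n, ContDiff ℝ 1 (η n)) ∧
    (∀ n p, ‖η n p‖ ≤ C) ∧ (∀ n p, ‖fderiv ℝ (η n) p‖ ≤ C * ((n : ℝ) + 1)⁻¹) ∧
    (∀ (n : ℕ) (p : ℝ × ℝ), 2 * ((n : ℝ) + 1) ≤ ‖p‖ → η n p = 0) ∧
    ∀ p, Tendsto (fun n => η n p) atTop (𝓝 1) := by
  let b : ContDiffBump (0 : ℝ × ℝ) := ⟨1, 2, one_pos, one_lt_two⟩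
  let f : ℝ × ℝ → ℂ := fun p => (b p : ℂ)
  have hf : ContDiff ℝ 1 f := Complex.ofRealCLM.contDiff.comp b.contDiff
  have hfs : HasCompactSupport f := b.hasCompactSupport.comp_left Complex.ofReal_zero
  obtain ⟨C₁, hC₁⟩ := hfs.exists_bound_of_continuous hf.continuous
  obtain ⟨C₂, hC₂⟩ := (hfs.fderiv ℝ).exists_bound_of_continuous (hf.continuous_fderiv (by norm_num))
  refine ⟨fun n p => f (((n : ℝ) + 1)⁻¹ • p), max C₁ C₂, fun n => ?_, fun n p => ?_, fun n p => ?_,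
    fun n p hp => ?_, fun p => ?_⟩
  · exact hf.comp (contDiff_const_smul _)
  · exact (hC₁ _).trans (le_max_left _ _)
  · rw [fderiv_comp_smul, norm_smul, Real.norm_of_nonneg (by positivity), mul_comm]
    gcongr
    exact (hC₂ _).trans (le_max_right _ _)
  · have : b (((n : ℝ) + 1)⁻¹ • p) = 0 := by
      refine b.zero_of_le_dist ?_
      rw [dist_zero_right, norm_smul, Real.norm_of_nonneg (by positivity), inv_mul_eq_div,
        le_div_iff₀ (by positivity)]
      exact hp
    simp [f, this]
  · have h1 : Tendsto (fun n : ℕ => ((n : ℝ) + 1)⁻¹ • p) atTop (𝓝 ((0 : ℝ) • p)) := by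
      refine Tendsto.smul_const ?_ p
      simpa using tendsto_one_div_add_atTop_nhds_zero_nat (𝕜 := ℝ)
    have h2 : Tendsto f (𝓝 ((0 : ℝ) • p)) (𝓝 1) := by
      have : f 0 = 1 := by simp [f, b.one_of_mem_closedBall (x := 0) (by simp [b])]
      rw [zero_smul, ← this]
      exact hf.continuous.tendsto 0
    exact h2.comp h1

section Green

variable {A : VectorPotential B} {ω lam : ℝ} {v w : ℝ × ℝ → ℂ}

/-- Green's identity `⟨w, H v⟩ = ⟨D w, D v⟩ + ⟨(i ∂_y + A₂) w, (i ∂_y + A₂) v⟩`. -/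
theorem MemD0.integral_hamiltonian (hlam : lam = -2 * ω) (hv : MemD0 A ω lam v)
    (hw : MemD0 A ω lam w) :
    ∫ p, conj (w p) * hamiltonian A ω v p = (∫ p, conj (factorX A ω w p) * factorX A ω v p) +
      ∫ p, conj (momentumY A w p) * momentumY A v p := by
  obtain ⟨η, C, hη, hηC, hηC', hs, hlim⟩ := exists_cutoff_sequence
  have hC0 : 0 ≤ C := (norm_nonneg _).trans (hηC 0 0)
  have i1 := integrable_conj_mul hw.memLp hv.memLp_hamiltonian
  have i2 := integrable_conj_mul hw.memLp_factorX hv.memLp_factorX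
  have i3 := integrable_conj_mul hw.memLp_Y hv.memLp_Y
  have i4 := integrable_conj_mul hw.memLp hv.memLp_factorX
  have i5 := integrable_conj_mul hw.memLp hv.memLp_Y
  set K := fun p => conj (w p) * hamiltonian A ω v p -
        conj (factorX A ω w p) * factorX A ω v p - conj (momentumY A w p) * momentumY A v p with hK
  have iK : Integrable K := (i1.sub i2).sub i3
  set F := fun p => ‖conj (w p) * factorX A ω v p‖ + ‖conj (w p) * momentumY A v p‖ with hF
  have iF : Integrable F := i4.norm.add i5.norm
  have hn1 : ∀ n : ℕ, ((n : ℝ) + 1)⁻¹ ≤ 1 := fun n => inv_le_one_of_one_le₀ (by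
    have : (0 : ℝ) ≤ n := n.cast_nonneg
    linarith)
  have hcut := fun n => hv.integral_cutoff hlam hw (hη n) (R := 2 * ((n : ℝ) + 1)) (C := C)
    (by positivity) (hs n) (hηC n) (fun p => (hηC' n p).trans (mul_le_of_le_one_right hC0 (hn1 n)))
  have hl1 : Tendsto (fun n => ∫ p, η n p * K p) atTop (𝓝 (∫ p, 1 * K p)) := by
    refine tendsto_integral_of_dominated_convergence (fun p => C * ‖K p‖)
      (fun n => (hη n).continuous.aestronglyMeasurable.mul iK.1) (iK.norm.const_mul C)
      (fun n => Eventually.of_forall fun p => ?_) (Eventually.of_forall fun p => ?_)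
    · rw [norm_mul]
      exact mul_le_mul_of_nonneg_right (hηC n p) (norm_nonneg _)
    · exact (hlim p).mul_const _
  -- The cut-off error contains only the gradient of `η n`, hence the factor `1 / (n + 1)`, against
  -- a fixed integrable function.
  have hb : ∀ n, ‖∫ p, η n p * K p‖ ≤ C * ((n : ℝ) + 1)⁻¹ * ∫ p, F p := fun n => by
    rw [hcut n, norm_mul, norm_neg, Complex.norm_I, one_mul, ← integral_const_mul]
    refine norm_integral_le_of_norm_le (iF.const_mul _) (Eventually.of_forall fun p => ?_)
    have he : ∀ e : ℝ × ℝ, ‖e‖ ≤ 1 → ‖fderiv ℝ (η n) p e‖ ≤ C * ((n : ℝ) + 1)⁻¹ := fun e he =>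
      ((fderiv ℝ (η n) p).le_opNorm e).trans
        ((mul_le_of_le_one_right (norm_nonneg _) he).trans (hηC' n p))
    refine (norm_add_le _ _).trans ?_
    rw [norm_mul, norm_mul (fderiv ℝ (η n) p (0, 1)), hF, mul_add]
    gcongr
    · exact he _ (by simp [Prod.norm_def])
    · exact he _ (by simp [Prod.norm_def])
  have hl0 : Tendsto (fun n => ∫ p, η n p * K p) atTop (𝓝 0) := by
    refine squeeze_zero_norm hb ?_
    have := ((tendsto_one_div_add_atTop_nhds_zero_nat (𝕜 := ℝ)).const_mul C).mul_const (∫ p, F p)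
    simpa using this
  have h0 := tendsto_nhds_unique hl1 hl0
  simp only [one_mul] at h0
  have e1 : ∫ p, K p = (∫ p, conj (w p) * hamiltonian A ω v p) -
      (∫ p, conj (factorX A ω w p) * factorX A ω v p) -
      ∫ p, conj (momentumY A w p) * momentumY A v p := by
    rw [← integral_sub i1 i2]
    exact integral_sub (i1.sub i2) i3
  rw [e1] at h0
  linear_combination h0

theorem inner_toLp {f g : ℝ × ℝ → ℂ} (hf : MemLp f 2 volume) (hg : MemLp g 2 volume) :
    inner ℂ (hf.toLp f) (hg.toLp g) = ∫ p, conj (f p) * g p := by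
  rw [L2.inner_def]
  refine integral_congr_ae ?_
  filter_upwards [hf.coeFn_toLp, hg.coeFn_toLp] with p h1 h2
  rw [h1, h2, RCLike.inner_apply, mul_comm]

theorem initialOperator_apply (hv : MemD0 A ω lam v)
    (h : hv.memLp.toLp v ∈ (initialOperator A ω lam).domain) :
    initialOperator A ω lam ⟨_, h⟩ = hv.memLp_hamiltonian.toLp (hamiltonian A ω v) := by
  have e : (LinearEquiv.ofInjective (D0.toL2 A ω lam) (D0.toL2_injective A ω lam)).symm ⟨_, h⟩ =
      (⟨v, hv⟩ : D0 A ω lam) := by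
    rw [LinearEquiv.symm_apply_eq]
    rfl
  change D0.toL2Hamiltonian A ω lam
    ((LinearEquiv.ofInjective (D0.toL2 A ω lam) (D0.toL2_injective A ω lam)).symm ⟨_, h⟩) = _
  rw [e]
  rfl

theorem mem_initialOperator_domain (hv : MemD0 A ω lam v) :
    hv.memLp.toLp v ∈ (initialOperator A ω lam).domain := ⟨⟨v, hv⟩, rfl⟩

/-- Written as a sum of two `L²` products, the form is visibly Hermitian and nonnegative. -/
theorem MemD0.inner_initialOperator (hlam : lam = -2 * ω) (hw : MemD0 A ω lam w)
    (hv : MemD0 A ω lam v) (h : hv.memLp.toLp v ∈ (initialOperator A ω lam).domain) :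
    inner ℂ (hw.memLp.toLp w) (initialOperator A ω lam ⟨_, h⟩) =
      inner ℂ (hw.memLp_factorX.toLp _) (hv.memLp_factorX.toLp _) +
        inner ℂ (hw.memLp_Y.toLp _) (hv.memLp_Y.toLp _) := by
  rw [initialOperator_apply hv, inner_toLp, inner_toLp, inner_toLp,
    hv.integral_hamiltonian hlam hw]

theorem initialOperator_isFormalAdjoint (hlam : lam = -2 * ω) :
    (initialOperator A ω lam).IsFormalAdjoint (initialOperator A ω lam) := by
  rintro ⟨_, ⟨w, hw⟩, rfl⟩ ⟨_, ⟨v, hv⟩, rfl⟩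
  have h1 := MemD0.inner_initialOperator hlam hw hv ⟨⟨v, hv⟩, rfl⟩
  have h2 := MemD0.inner_initialOperator hlam hv hw ⟨⟨w, hw⟩, rfl⟩
  refine Eq.trans ?_ h1.symm
  rw [← inner_conj_symm]
  refine (congrArg conj h2).trans ?_
  rw [map_add, inner_conj_symm, inner_conj_symm]

theorem initialOperator_form_nonneg (hlam : lam = -2 * ω) (u : (initialOperator A ω lam).domain) :
    0 ≤ (initialOperator A ω lam).form u := by
  obtain ⟨_, ⟨v, hv⟩, rfl⟩ := u
  have h1 := MemD0.inner_initialOperator hlam hv hv ⟨⟨v, hv⟩, rfl⟩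
  refine le_of_le_of_eq ?_ (congrArg Complex.re h1).symm
  rw [Complex.add_re]
  exact add_nonneg (inner_self_nonneg (𝕜 := ℂ)) (inner_self_nonneg (𝕜 := ℂ))

end Green

/-! ### Density of the initial domain -/

theorem momentum_contDiff {a : ℝ × ℝ → ℝ} (ha : ContDiff ℝ 1 a) {e : ℝ × ℝ} {v : ℝ × ℝ → ℂ}
    {m n : WithTop ℕ∞} (hm : m ≤ 1) (hmn : m + 1 ≤ n) (hv : ContDiff ℝ n v) :
    ContDiff ℝ m (momentum a e v) :=
  (contDiff_const.mul ((hv.fderiv_right hmn).clm_apply contDiff_const)).add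
    ((Complex.ofRealCLM.contDiff.comp (ha.of_le hm)).mul (hv.of_le (le_self_add.trans hmn)))

theorem momentum_hasCompactSupport {a : ℝ × ℝ → ℝ} {e : ℝ × ℝ} {v : ℝ × ℝ → ℂ}
    (hv : HasCompactSupport v) : HasCompactSupport (momentum a e v) := by
  refine hv.mono' fun p hp => ?_
  by_contra hn
  refine hp ?_
  have h1 : fderiv ℝ v p = 0 := by
    by_contra h
    exact hn (support_fderiv_subset ℝ h)
  simp [momentum, h1, image_eq_zero_of_notMem_tsupport hn]

/-- For a smooth function vanishing near the line, both sides of the matching condition are zero. -/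
theorem memD0_of_hasCompactSupport (A : VectorPotential B) (ω lam : ℝ) {g : ℝ × ℝ → ℂ}
    (hg : ContDiff ℝ 2 g) (hc : HasCompactSupport g) (hs : tsupport g ⊆ {p | p.1 ≠ 0}) :
    MemD0 A ω lam g where
  right := hg.contDiffOn
  left := hg.contDiffOn
  jump y := by
    have h0 : g (0, y) = 0 := image_eq_zero_of_notMem_tsupport fun h => hs h rfl
    have hd : DifferentiableAt ℝ (fun x : ℝ => g (x, y)) 0 :=
      (hg.differentiable (by norm_num) _).comp (0 : ℝ)
        (by fun_prop : DifferentiableAt ℝ (fun x : ℝ => (x, y)) 0)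
    rw [hd.derivWithin (uniqueDiffOn_Ici 0 0 (by simp)),
      hd.derivWithin (uniqueDiffOn_Iic 0 0 (by simp)), h0]
    simp
  memLp := hg.continuous.memLp_of_hasCompactSupport hc
  memLp_X := Continuous.memLp_of_hasCompactSupport
    (momentum_contDiff A.contDiff₁ le_rfl (by norm_num) hg).continuous
    (momentum_hasCompactSupport hc)
  memLp_Y := Continuous.memLp_of_hasCompactSupport
    (momentum_contDiff A.contDiff₂ le_rfl (by norm_num) hg).continuous
    (momentum_hasCompactSupport hc)
  memLp_y := ((Complex.continuous_ofReal.comp continuous_snd).mul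
    hg.continuous).memLp_of_hasCompactSupport hc.mul_left
  memLp_hamiltonian := by
    refine Continuous.memLp_of_hasCompactSupport ?_ ?_
    · exact ((momentum_contDiff A.contDiff₁ (m := 0) (n := 1) (by norm_num) (by norm_num)
          (momentum_contDiff A.contDiff₁ le_rfl (by norm_num) hg)).continuous.add
        (momentum_contDiff A.contDiff₂ (m := 0) (n := 1) (by norm_num) (by norm_num)
          (momentum_contDiff A.contDiff₂ le_rfl (by norm_num) hg)).continuous).add
        ((Complex.continuous_ofReal.comp (by fun_prop)).mul hg.continuous)
    · exact ((momentum_hasCompactSupport (momentum_hasCompactSupport hc)).add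
        (momentum_hasCompactSupport (momentum_hasCompactSupport hc))).add hc.mul_left

/-- A vector orthogonal to the domain integrates to zero against all test functions supported in `x
≠ 0`, so it vanishes almost everywhere off a null line. -/
theorem initialOperator_dense (A : VectorPotential B) (ω lam : ℝ) :
    Dense ((initialOperator A ω lam).domain : Set L2Plane) := by
  rw [Submodule.dense_iff_topologicalClosure_eq_top, Submodule.topologicalClosure_eq_top_iff,
    Submodule.eq_bot_iff]
  intro f hf
  rw [Submodule.mem_orthogonal] at hf
  have hU : IsOpen {p : ℝ × ℝ | p.1 ≠ 0} := isOpen_ne_fun continuous_fst continuous_const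
  have hae := hU.ae_eq_zero_of_integral_contDiff_smul_eq_zero (μ := volume) (f := f)
    (((Lp.memLp f).locallyIntegrable (by norm_num)).locallyIntegrableOn _) (fun g hg hc hs => by
      have hgs : tsupport (fun p => (g p : ℂ)) ⊆ tsupport g :=
        closure_mono (Function.support_comp_subset Complex.ofReal_zero g)
      have hg2 : ContDiff ℝ 2 (fun p => (g p : ℂ)) :=
        Complex.ofRealCLM.contDiff.comp (hg.of_le (WithTop.coe_le_coe.2 le_top))
      have hD := memD0_of_hasCompactSupport A ω lam hg2 (hc.comp_left Complex.ofReal_zero)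
        (hgs.trans hs)
      have h0 := hf _ (mem_initialOperator_domain hD)
      rw [L2.inner_def] at h0
      rw [← h0]
      refine integral_congr_ae ?_
      filter_upwards [hD.memLp.coeFn_toLp] with p hp
      rw [hp, RCLike.inner_apply, Complex.real_smul, Complex.conj_ofReal, mul_comm])
  refine (Lp.eq_zero_iff_ae_eq_zero).2 ?_
  filter_upwards [hae, ae_fst_ne_zero] with p h1 h2
  exact h1 h2

theorem initialOperator_isNonnegSymmetric (A : VectorPotential B) {ω lam : ℝ}
    (hlam : lam = -2 * ω) : (initialOperator A ω lam).IsNonnegSymmetric where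
  dense := initialOperator_dense A ω lam
  symmetric := initialOperator_isFormalAdjoint hlam
  nonneg := initialOperator_form_nonneg hlam

/-! ### Gauge transformation -/

/-- Up to the gradient of a gauge function, `A` is the potential `(0, B x - k)`. -/
theorem VectorPotential.exists_gauge (A : VectorPotential B) (k : ℝ) : ∃ χ : ℝ × ℝ → ℝ,
    ContDiff ℝ 2 χ ∧ ∀ p, fderiv ℝ χ p (1, 0) = A.A₁ p ∧
      fderiv ℝ χ p (0, 1) = A.A₂ p - B * p.1 + k := by
  let α : ℝ × ℝ → ℝ × ℝ →L[ℝ] ℝ := fun p => A.A₁ p • ContinuousLinearMap.fst ℝ ℝ ℝ +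
    (A.A₂ p - B * p.1 + k) • ContinuousLinearMap.snd ℝ ℝ ℝ
  have hα : ContDiff ℝ 1 α := (A.contDiff₁.smul contDiff_const).add
    (((A.contDiff₂.sub (contDiff_const.mul contDiff_fst)).add contDiff_const).smul contDiff_const)
  have h1 : ∀ p, HasFDerivAt A.A₁ (fderiv ℝ A.A₁ p) p := fun p =>
    (A.contDiff₁.differentiable (by norm_num) p).hasFDerivAt
  have h2 : ∀ p, HasFDerivAt A.A₂ (fderiv ℝ A.A₂ p) p := fun p =>
    (A.contDiff₂.differentiable (by norm_num) p).hasFDerivAt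
  -- The form `α` is closed: subtracting `B x` from `A₂` removes the curl, and the constant `k` does
  -- not affect it. The Poincaré lemma then provides `χ`.
  have hsym : ∀ p ∈ (univ : Set (ℝ × ℝ)), ∀ x y, fderiv ℝ α p x y = fderiv ℝ α p y x := by
    intro p _ x y
    have hfst : HasFDerivAt (fun q : ℝ × ℝ => q.1) (ContinuousLinearMap.fst ℝ ℝ ℝ) p :=
      (ContinuousLinearMap.fst ℝ ℝ ℝ).hasFDerivAt
    have hd := (((h1 p).smul_const (ContinuousLinearMap.fst ℝ ℝ ℝ)).add
      ((((h2 p).sub (hfst.const_mul B)).add_const k).smul_const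
        (ContinuousLinearMap.snd ℝ ℝ ℝ))).fderiv
    have hdec : ∀ (L : ℝ × ℝ →L[ℝ] ℝ) (z : ℝ × ℝ), L z = z.1 * L (1, 0) + z.2 * L (0, 1) := by
      intro L z
      have : z = z.1 • ((1 : ℝ), (0 : ℝ)) + z.2 • ((0 : ℝ), (1 : ℝ)) := by ext <;> simp
      conv_lhs => rw [this, map_add, map_smul, map_smul]
      simp
    have hc := A.curl p
    change fderiv ℝ α p = _ at hd
    rw [hd]
    simp only [_root_.add_apply, _root_.sub_apply, _root_.smul_apply,
      ContinuousLinearMap.smulRight_apply, ContinuousLinearMap.coe_fst',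
      ContinuousLinearMap.coe_snd', smul_eq_mul]
    rw [hdec (fderiv ℝ A.A₁ p) x, hdec (fderiv ℝ A.A₁ p) y, hdec (fderiv ℝ A.A₂ p) x,
      hdec (fderiv ℝ A.A₂ p) y]
    linear_combination (x.1 * y.2 - y.1 * x.2) * hc
  obtain ⟨χ, hχ⟩ := convex_univ.exists_forall_hasFDerivAt_of_fderiv_symmetric isOpen_univ
    (hα.differentiable (by norm_num)).differentiableOn hsym
  have hfd : fderiv ℝ χ = α := funext fun p => (hχ p (mem_univ p)).fderiv
  refine ⟨χ, ?_, fun p => ?_⟩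
  · rw [show (2 : WithTop ℕ∞) = 1 + 1 by norm_num, contDiff_succ_iff_fderiv]
    exact ⟨fun p => (hχ p (mem_univ p)).differentiableAt, by simp, hfd ▸ hα⟩
  · simp [hfd, α]

/-! ### Weyl sequences -/

theorem hasFDerivAt_mul_exp {θ Q : ℝ × ℝ → ℂ} {θ' Q' : ℝ × ℝ →L[ℝ] ℂ} {p : ℝ × ℝ}
    (hQ : HasFDerivAt Q Q' p) (hθ : HasFDerivAt θ θ' p) :
    HasFDerivAt (fun q => Q q * Complex.exp (θ q))
      (Complex.exp (θ p) • (Q' + Q p • θ')) p := by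
  refine (hQ.fun_mul hθ.cexp).congr_fderiv ?_
  ext <;> simp <;> ring

/-- Conjugation by `exp θ` shifts the potential by `i ∂ₑ θ`. Since the result again has the form
prefactor times `exp θ`, the rule can be applied twice. -/
theorem momentum_mul_exp {a : ℝ × ℝ → ℝ} {e p : ℝ × ℝ} {θ Q : ℝ × ℝ → ℂ}
    {θ' Q' : ℝ × ℝ →L[ℝ] ℂ} (hQ : HasFDerivAt Q Q' p) (hθ : HasFDerivAt θ θ' p) :
    momentum a e (fun q => Q q * Complex.exp (θ q)) p =
      (Complex.I * Q' e + (Complex.I * θ' e + a p) * Q p) * Complex.exp (θ p) := by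
  rw [momentum, (hasFDerivAt_mul_exp hQ hθ).fderiv]
  simp only [_root_.add_apply, _root_.smul_apply, smul_eq_mul]
  ring

theorem momentum_congr {a : ℝ × ℝ → ℝ} {e p : ℝ × ℝ} {v w : ℝ × ℝ → ℂ} (h : v =ᶠ[𝓝 p] w) :
    momentum a e v =ᶠ[𝓝 p] momentum a e w := by
  filter_upwards [h, h.fderiv (𝕜 := ℝ)] with q h1 h2
  rw [momentum, momentum, h1, h2]

theorem hamiltonian_congr {A : VectorPotential B} {ω : ℝ} {p : ℝ × ℝ} {v w : ℝ × ℝ → ℂ}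
    (h : v =ᶠ[𝓝 p] w) : hamiltonian A ω v p = hamiltonian A ω w p := by
  have h1 := (momentum_congr (a := A.A₁) (e := (1, 0))
    (momentum_congr (a := A.A₁) (e := (1, 0)) h)).eq_of_nhds
  have h2 := (momentum_congr (a := A.A₂) (e := (0, 1))
    (momentum_congr (a := A.A₂) (e := (0, 1)) h)).eq_of_nhds
  simp only [hamiltonian, momentumX, momentumY]
  rw [h1, h2, h.eq_of_nhds]

/-- The phase `i χ - s ω x y`. -/
def phase (χ : ℝ × ℝ → ℝ) (ω s : ℝ) (p : ℝ × ℝ) : ℂ :=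
  Complex.I * χ p - s * ω * (p.1 * p.2)

/-- The function `f(y) exp(i χ - s ω x y)`. -/
def planeFun (χ : ℝ × ℝ → ℝ) (ω s : ℝ) (f : ℝ → ℝ) (p : ℝ × ℝ) : ℂ :=
  f p.2 * Complex.exp (phase χ ω s p)

/-- The function `f(y) exp(i χ - ω y |x|)`. -/
def weylFun (χ : ℝ × ℝ → ℝ) (ω : ℝ) (f : ℝ → ℝ) (p : ℝ × ℝ) : ℂ :=
  planeFun χ ω (sgn p.1) f p

section Weyl

variable {A : VectorPotential B} {χ : ℝ × ℝ → ℝ} {ω k s : ℝ} {f f₁ f₂ : ℝ → ℝ}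

theorem hasFDerivAt_ofReal_fst (p : ℝ × ℝ) : HasFDerivAt (fun q : ℝ × ℝ => (q.1 : ℂ))
    (Complex.ofRealCLM.comp (ContinuousLinearMap.fst ℝ ℝ ℝ)) p :=
  Complex.ofRealCLM.hasFDerivAt.comp p (ContinuousLinearMap.fst ℝ ℝ ℝ).hasFDerivAt

theorem hasFDerivAt_ofReal_snd (p : ℝ × ℝ) : HasFDerivAt (fun q : ℝ × ℝ => (q.2 : ℂ))
    (Complex.ofRealCLM.comp (ContinuousLinearMap.snd ℝ ℝ ℝ)) p :=
  Complex.ofRealCLM.hasFDerivAt.comp p (ContinuousLinearMap.snd ℝ ℝ ℝ).hasFDerivAt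

theorem hasFDerivAt_comp_snd {p : ℝ × ℝ} {d : ℝ} (hf : HasDerivAt f d p.2) :
    HasFDerivAt (fun q : ℝ × ℝ => (f q.2 : ℂ))
      (Complex.ofRealCLM.comp (d • ContinuousLinearMap.snd ℝ ℝ ℝ)) p :=
  Complex.ofRealCLM.hasFDerivAt.comp p
    (hf.comp_hasFDerivAt p (ContinuousLinearMap.snd ℝ ℝ ℝ).hasFDerivAt)

theorem hasFDerivAt_phase (hχ : ContDiff ℝ 2 χ) (p : ℝ × ℝ) :
    HasFDerivAt (phase χ ω s) (Complex.I • Complex.ofRealCLM.comp (fderiv ℝ χ p) -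
      ((s : ℂ) * ω) • ((p.1 : ℂ) • Complex.ofRealCLM.comp (ContinuousLinearMap.snd ℝ ℝ ℝ) +
        (p.2 : ℂ) • Complex.ofRealCLM.comp (ContinuousLinearMap.fst ℝ ℝ ℝ))) p := by
  have h1 : HasFDerivAt (fun q => (χ q : ℂ)) (Complex.ofRealCLM.comp (fderiv ℝ χ p)) p :=
    Complex.ofRealCLM.hasFDerivAt.comp p (hχ.differentiable (by norm_num) p).hasFDerivAt
  exact (h1.const_mul Complex.I).sub
    (((hasFDerivAt_ofReal_fst p).mul (hasFDerivAt_ofReal_snd p)).const_mul ((s : ℂ) * ω))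

theorem planeFun_contDiff (hχ : ContDiff ℝ 2 χ) (hf : ContDiff ℝ 2 f) :
    ContDiff ℝ 2 (planeFun χ ω s f) :=
  (Complex.ofRealCLM.contDiff.comp (hf.comp contDiff_snd)).mul
    ((contDiff_const.mul (Complex.ofRealCLM.contDiff.comp hχ)).sub
      (contDiff_const.mul ((Complex.ofRealCLM.contDiff.comp contDiff_fst).mul
        (Complex.ofRealCLM.contDiff.comp contDiff_snd)))).cexp

/-- The gauge cancels `A₁`, leaving only the contribution of `- s ω x y`. -/
theorem momentumX_mul_exp (hχ : ContDiff ℝ 2 χ) (hA : ∀ p, fderiv ℝ χ p (1, 0) = A.A₁ p)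
    {Q : ℝ × ℝ → ℂ} {Q' : ℝ × ℝ →L[ℝ] ℂ} {p : ℝ × ℝ} (hQ : HasFDerivAt Q Q' p) :
    momentumX A (fun q => Q q * Complex.exp (phase χ ω s q)) p =
      (Complex.I * Q' (1, 0) - Complex.I * s * ω * p.2 * Q p) * Complex.exp (phase χ ω s p) := by
  rw [momentumX, momentum_mul_exp hQ (hasFDerivAt_phase hχ p)]
  simp only [_root_.add_apply, _root_.sub_apply, _root_.smul_apply, smul_eq_mul,
    ContinuousLinearMap.comp_apply, ContinuousLinearMap.coe_fst', ContinuousLinearMap.coe_snd', hA,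
    Complex.ofRealCLM_apply, Complex.ofReal_zero, Complex.ofReal_one]
  linear_combination (A.A₁ p * Q p * Complex.exp (phase χ ω s p)) * Complex.I_mul_I

/-- The gauge replaces `A₂` by `B x - k`; the real part of the phase adds `- i s ω x`, so that `x`
has the complex coefficient `B - i s ω`. -/
theorem momentumY_mul_exp (hχ : ContDiff ℝ 2 χ)
    (hA : ∀ p, fderiv ℝ χ p (0, 1) = A.A₂ p - B * p.1 + k)
    {Q : ℝ × ℝ → ℂ} {Q' : ℝ × ℝ →L[ℝ] ℂ} {p : ℝ × ℝ} (hQ : HasFDerivAt Q Q' p) :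
    momentumY A (fun q => Q q * Complex.exp (phase χ ω s q)) p =
      (Complex.I * Q' (0, 1) + ((B - Complex.I * s * ω) * p.1 - k) * Q p) *
        Complex.exp (phase χ ω s p) := by
  rw [momentumY, momentum_mul_exp hQ (hasFDerivAt_phase hχ p)]
  simp only [_root_.add_apply, _root_.sub_apply, _root_.smul_apply, smul_eq_mul,
    ContinuousLinearMap.comp_apply, ContinuousLinearMap.coe_fst', ContinuousLinearMap.coe_snd', hA,
    Complex.ofRealCLM_apply, Complex.ofReal_zero, Complex.ofReal_one]
  push_cast
  linear_combination ((A.A₂ p - B * p.1 + k) * Q p * Complex.exp (phase χ ω s p)) * Complex.I_mul_I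

theorem momentumX_planeFun (hχ : ContDiff ℝ 2 χ) (hA : ∀ p, fderiv ℝ χ p (1, 0) = A.A₁ p)
    (hf : ∀ y, HasDerivAt f (f₁ y) y) :
    momentumX A (planeFun χ ω s f) = fun p =>
      (-Complex.I * s * ω) * (p.2 * f p.2) * Complex.exp (phase χ ω s p) := by
  funext p
  unfold planeFun
  rw [momentumX_mul_exp hχ hA (hasFDerivAt_comp_snd (hf p.2))]
  simp only [ContinuousLinearMap.comp_apply, _root_.smul_apply, ContinuousLinearMap.coe_snd',
    Complex.ofRealCLM_apply, smul_zero, Complex.ofReal_zero]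
  ring

/-- For `s = ±1` this cancels the potential `ω² y²`. -/
theorem momentumX_momentumX_planeFun (hχ : ContDiff ℝ 2 χ)
    (hA : ∀ p, fderiv ℝ χ p (1, 0) = A.A₁ p) (hf : ∀ y, HasDerivAt f (f₁ y) y) (p : ℝ × ℝ) :
    momentumX A (momentumX A (planeFun χ ω s f)) p =
      (-s ^ 2 * ω ^ 2) * p.2 ^ 2 * planeFun χ ω s f p := by
  rw [momentumX_planeFun hχ hA hf, momentumX_mul_exp hχ hA
    (((hasFDerivAt_ofReal_snd p).fun_mul (hasFDerivAt_comp_snd (hf p.2))).const_mul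
      (-Complex.I * s * ω))]
  simp only [ContinuousLinearMap.comp_apply, _root_.smul_apply, _root_.add_apply,
    ContinuousLinearMap.coe_snd', Complex.ofRealCLM_apply, smul_zero, Complex.ofReal_zero,
    planeFun]
  linear_combination (s ^ 2 * ω ^ 2 * p.2 ^ 2 * f p.2 * Complex.exp (phase χ ω s p)) *
    Complex.I_mul_I

theorem momentumY_planeFun (hχ : ContDiff ℝ 2 χ)
    (hA : ∀ p, fderiv ℝ χ p (0, 1) = A.A₂ p - B * p.1 + k)
    (hf : ∀ y, HasDerivAt f (f₁ y) y) :
    momentumY A (planeFun χ ω s f) = fun p =>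
      (Complex.I * f₁ p.2 + ((B - Complex.I * s * ω) * p.1 - k) * f p.2) *
        Complex.exp (phase χ ω s p) := by
  funext p
  unfold planeFun
  rw [momentumY_mul_exp hχ hA (hasFDerivAt_comp_snd (hf p.2))]
  simp [ContinuousLinearMap.comp_apply]

theorem momentumY_momentumY_planeFun (hχ : ContDiff ℝ 2 χ)
    (hA : ∀ p, fderiv ℝ χ p (0, 1) = A.A₂ p - B * p.1 + k)
    (hf : ∀ y, HasDerivAt f (f₁ y) y) (hf₁ : ∀ y, HasDerivAt f₁ (f₂ y) y) (p : ℝ × ℝ) :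
    momentumY A (momentumY A (planeFun χ ω s f)) p =
      (-f₂ p.2 + 2 * Complex.I * ((B - Complex.I * s * ω) * p.1 - k) * f₁ p.2 +
        ((B - Complex.I * s * ω) * p.1 - k) ^ 2 * f p.2) * Complex.exp (phase χ ω s p) := by
  rw [momentumY_planeFun hχ hA hf, momentumY_mul_exp hχ hA
    (((hasFDerivAt_comp_snd (hf₁ p.2)).const_mul Complex.I).fun_add
      ((((hasFDerivAt_ofReal_fst p).const_mul (B - Complex.I * s * ω)).sub_const (k : ℂ)).fun_mul
        (hasFDerivAt_comp_snd (hf p.2))))]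
  simp only [ContinuousLinearMap.comp_apply, _root_.smul_apply, _root_.add_apply,
    ContinuousLinearMap.coe_snd', ContinuousLinearMap.coe_fst', Complex.ofRealCLM_apply,
    Complex.ofReal_zero, smul_eq_mul, mul_one]
  linear_combination (f₂ p.2 * Complex.exp (phase χ ω s p)) * Complex.I_mul_I

theorem weylFun_eventuallyEq (χ : ℝ × ℝ → ℝ) (ω : ℝ) (f : ℝ → ℝ) {p : ℝ × ℝ} (hp : p.1 ≠ 0) :
    weylFun χ ω f =ᶠ[𝓝 p] planeFun χ ω (sgn p.1) f := by
  filter_upwards [sgn_eventuallyEq hp] with q hq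
  rw [weylFun, hq]

/-- At `x = 0` the function `sgn` takes the value `-1`, but there the phase does not depend on `s`,
so the identity reaches the line. -/
theorem weylFun_right {p : ℝ × ℝ} (hp : 0 ≤ p.1) :
    weylFun χ ω f p = planeFun χ ω 1 f p := by
  rcases hp.eq_or_lt with h | h
  · simp [weylFun, planeFun, phase, ← h]
  · simp [weylFun, sgn, h]

theorem weylFun_left {p : ℝ × ℝ} (hp : p.1 ≤ 0) :
    weylFun χ ω f p = planeFun χ ω (-1) f p := by
  simp [weylFun, sgn, not_lt.2 hp]

theorem hasDerivAt_planeFun (hχ : ContDiff ℝ 2 χ) (hf : ∀ y, HasDerivAt f (f₁ y) y) (y : ℝ) :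
    HasDerivAt (fun x => planeFun χ ω s f (x, y))
      ((Complex.I * fderiv ℝ χ (0, y) (1, 0) - s * ω * y) * planeFun χ ω s f (0, y)) 0 := by
  have h1 : HasDerivAt (fun x : ℝ => (x, y)) ((1 : ℝ), (0 : ℝ)) 0 :=
    (hasDerivAt_id _).prodMk (hasDerivAt_const _ _)
  have h2 := HasFDerivAt.comp_hasDerivAt (0 : ℝ) (f := fun x : ℝ => (x, y))
    (hasFDerivAt_mul_exp (hasFDerivAt_comp_snd (p := (0, y)) (hf y))
      (hasFDerivAt_phase (ω := ω) (s := s) hχ (0, y)))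
    h1
  refine h2.congr_deriv ?_
  simp [planeFun]
  ring

/-- The exponent `-ω y |x|` has a derivative jump of `-2 ω y` at `x = 0`; the gauge function is
smooth and contributes none. -/
theorem weylFun_jump (hχ : ContDiff ℝ 2 χ) (hf : ∀ y, HasDerivAt f (f₁ y) y) (y : ℝ) :
    derivWithin (fun x : ℝ => weylFun χ ω f (x, y)) (Ici 0) 0 -
      derivWithin (fun x : ℝ => weylFun χ ω f (x, y)) (Iic 0) 0 =
    ((-2 * ω) * y : ℝ) * weylFun χ ω f (0, y) := by
  have e1 : derivWithin (fun x : ℝ => weylFun χ ω f (x, y)) (Ici 0) 0 =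
      (Complex.I * fderiv ℝ χ (0, y) (1, 0) - (1 : ℝ) * ω * y) * planeFun χ ω 1 f (0, y) := by
    rw [derivWithin_congr (s := Ici 0) (f := fun x : ℝ => planeFun χ ω 1 f (x, y))
      (fun x hx => weylFun_right (p := (x, y)) hx) (weylFun_right (p := (0, y)) le_rfl)]
    exact (hasDerivAt_planeFun hχ hf y).hasDerivWithinAt.derivWithin
      (uniqueDiffOn_Ici 0 0 (by simp))
  have e2 : derivWithin (fun x : ℝ => weylFun χ ω f (x, y)) (Iic 0) 0 =
      (Complex.I * fderiv ℝ χ (0, y) (1, 0) - (-1 : ℝ) * ω * y) * planeFun χ ω (-1) f (0, y) := by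
    rw [derivWithin_congr (s := Iic 0) (f := fun x : ℝ => planeFun χ ω (-1) f (x, y))
      (fun x hx => weylFun_left (p := (x, y)) hx) (weylFun_left (p := (0, y)) le_rfl)]
    exact (hasDerivAt_planeFun hχ hf y).hasDerivWithinAt.derivWithin
      (uniqueDiffOn_Iic 0 0 (by simp))
  rw [e1, e2, ← weylFun_left (p := (0, y)) le_rfl, ← weylFun_right (p := (0, y)) le_rfl]
  push_cast
  ring

/-- The potential and `k²` cancel. Each surviving term contains a derivative of `f` or a factor `x`,
which is what makes it small for large `N`. -/
theorem weylFun_hamiltonian (hχ : ContDiff ℝ 2 χ)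
    (hA : ∀ p, fderiv ℝ χ p (1, 0) = A.A₁ p ∧ fderiv ℝ χ p (0, 1) = A.A₂ p - B * p.1 + k)
    (hf : ∀ y, HasDerivAt f (f₁ y) y) (hf₁ : ∀ y, HasDerivAt f₁ (f₂ y) y) {p : ℝ × ℝ}
    (hp : p.1 ≠ 0) :
    hamiltonian A ω (weylFun χ ω f) p - k ^ 2 * weylFun χ ω f p =
      (-f₂ p.2 + 2 * Complex.I * ((B - Complex.I * sgn p.1 * ω) * p.1 - k) * f₁ p.2 +
        ((B - Complex.I * sgn p.1 * ω) ^ 2 * p.1 ^ 2 -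
          2 * k * (B - Complex.I * sgn p.1 * ω) * p.1) * f p.2) *
        Complex.exp (phase χ ω (sgn p.1) p) := by
  rw [hamiltonian_congr (weylFun_eventuallyEq χ ω f hp), hamiltonian,
    momentumX_momentumX_planeFun hχ (fun p => (hA p).1) hf,
    momentumY_momentumY_planeFun hχ (fun p => (hA p).2) hf hf₁, weylFun, planeFun]
  have hs : (sgn p.1 : ℂ) * sgn p.1 = 1 := by exact_mod_cast sgn_mul_self p.1
  push_cast
  linear_combination (-ω ^ 2 * p.2 ^ 2 * f p.2 * Complex.exp (phase χ ω (sgn p.1) p)) * hs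

/-- Since `χ` is real, the gauge factor has modulus one; the rest decays in `x` exactly when `y >
0`. -/
theorem norm_exp_phase (χ : ℝ × ℝ → ℝ) (ω : ℝ) (p : ℝ × ℝ) :
    ‖Complex.exp (phase χ ω (sgn p.1) p)‖ = Real.exp (-(ω * (p.2 * |p.1|))) := by
  have h : sgn p.1 * p.1 = |p.1| := by
    unfold sgn
    split_ifs with h
    · rw [one_mul, abs_of_pos h]
    · rw [abs_of_nonpos (not_lt.1 h)]; ring
  rw [Complex.norm_exp]
  congr 1
  have : phase χ ω (sgn p.1) p = Complex.I * χ p + ((-(ω * (p.2 * |p.1|)) : ℝ) : ℂ) := by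
    rw [phase, ← h]; push_cast; ring
  rw [this]
  simp

end Weyl

/-! ### Profiles, the transversal weight and `L²` bounds -/

/-- Slowly varying cut-off functions on `[N, 2 N]`. -/
theorem exists_profile : ∃ C : ℝ, 0 ≤ C ∧ ∀ N : ℝ, 1 ≤ N → ∃ f f₁ f₂ : ℝ → ℝ, ContDiff ℝ 2 f ∧
    (∀ y, HasDerivAt f (f₁ y) y) ∧ (∀ y, HasDerivAt f₁ (f₂ y) y) ∧
    (∀ y, |f y| ≤ C) ∧ (∀ y, |f₁ y| ≤ C / N) ∧ (∀ y, |f₂ y| ≤ C / N) ∧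
    (∀ y, y ∉ Icc N (2 * N) → f y = 0 ∧ f₁ y = 0 ∧ f₂ y = 0) ∧
    ∀ y ∈ Icc (5 / 4 * N) (7 / 4 * N), f y = 1 := by
  -- These radii give support `[1, 2]` and the value 1 on `[5 / 4, 7 / 4]`; the profile is `b (y /
  -- N)`.
  let b : ContDiffBump (3 / 2 : ℝ) := ⟨1 / 4, 1 / 2, by norm_num, by norm_num⟩
  have hb : ContDiff ℝ 3 b := b.contDiff (n := 3)
  have hb1 : ContDiff ℝ 2 (deriv b) := ((contDiff_succ_iff_deriv (n := 2)).1 hb).2.2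
  have hb2 : ContDiff ℝ 1 (deriv (deriv b)) := ((contDiff_succ_iff_deriv (n := 1)).1 hb1).2.2
  have hs1 := b.hasCompactSupport.deriv
  obtain ⟨C₀, hC₀⟩ := b.hasCompactSupport.exists_bound_of_continuous hb.continuous
  obtain ⟨C₁, hC₁⟩ := hs1.exists_bound_of_continuous hb1.continuous
  obtain ⟨C₂, hC₂⟩ := hs1.deriv.exists_bound_of_continuous hb2.continuous
  have h0 : ∀ x : ℝ, x ∉ Icc (1 : ℝ) 2 → b x = 0 ∧ deriv b x = 0 ∧ deriv (deriv b) x = 0 := by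
    intro x hx
    have ht : tsupport b = Icc (1 : ℝ) 2 := by
      rw [b.tsupport_eq, Real.closedBall_eq_Icc]
      norm_num [b]
    have hx0 : x ∉ tsupport b := by rwa [ht]
    have hx1 : x ∉ tsupport (deriv b) := fun h => hx0
      (closure_minimal (support_deriv_subset (f := b)) (isClosed_tsupport b) h)
    refine ⟨image_eq_zero_of_notMem_tsupport hx0, image_eq_zero_of_notMem_tsupport hx1, ?_⟩
    by_contra h
    exact hx1 (support_deriv_subset h)
  set C := max C₀ (max C₁ C₂)
  have hC : 0 ≤ C := ((norm_nonneg _).trans (hC₀ 0)).trans (le_max_left _ _)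
  have hd : ∀ N y : ℝ, HasDerivAt (fun y => N⁻¹ * y) N⁻¹ y := fun N y => by
    simpa using (hasDerivAt_id y).const_mul N⁻¹
  refine ⟨C, hC, fun N hN => ?_⟩
  have hN0 : 0 < N := by linarith
  have hmem : ∀ y, N⁻¹ * y ∈ Icc (1 : ℝ) 2 → y ∈ Icc N (2 * N) := fun y hy => by
    rw [inv_mul_eq_div, mem_Icc, le_div_iff₀ hN0, div_le_iff₀ hN0, one_mul] at hy
    exact hy
  refine ⟨fun y => b (N⁻¹ * y), fun y => deriv b (N⁻¹ * y) * N⁻¹,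
    fun y => deriv (deriv b) (N⁻¹ * y) * N⁻¹ * N⁻¹, ?_, fun y => ?_, fun y => ?_, fun y => ?_,
    fun y => ?_, fun y => ?_, fun y hy => ?_, fun y hy => ?_⟩
  · exact (hb.of_le (by norm_num)).comp (contDiff_const.mul contDiff_id)
  · exact ((hb.differentiable (by norm_num) _).hasDerivAt).comp y (hd N y)
  · exact (((hb1.differentiable (by norm_num) _).hasDerivAt).comp y (hd N y)).mul_const _
  · exact (hC₀ _).trans (le_max_left _ _)
  · rw [abs_mul, abs_of_pos (inv_pos.2 hN0), div_eq_mul_inv C N]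
    gcongr
    exact (hC₁ _).trans ((le_max_left _ _).trans (le_max_right _ _))
  · rw [abs_mul, abs_mul, abs_of_pos (inv_pos.2 hN0), div_eq_mul_inv C N]
    have h1 : |deriv (deriv b) (N⁻¹ * y)| * N⁻¹ ≤ C * N⁻¹ := by
      gcongr
      exact (hC₂ _).trans ((le_max_right _ _).trans (le_max_right _ _))
    -- The second derivative is of order `N⁻²`; one power is discarded, as `1 / N` suffices.
    exact (mul_le_of_le_one_right (by positivity) (inv_le_one_of_one_le₀ hN)).trans h1
  · obtain ⟨h1, h2, h3⟩ := h0 (N⁻¹ * y) fun h => hy (hmem y h)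
    simp only [h1, h2, h3, zero_mul, and_self]
  · refine b.one_of_mem_closedBall ?_
    rw [Real.closedBall_eq_Icc, inv_mul_eq_div, mem_Icc, le_div_iff₀ hN0, div_le_iff₀ hN0]
    norm_num [b]
    exact hy

/-- The transversal weight `(1 + |t|)² exp(-ω |t|)`. -/
def weight (ω t : ℝ) : ℝ := (1 + |t|) ^ 2 * Real.exp (-(ω * |t|))

theorem weight_nonneg (ω t : ℝ) : 0 ≤ weight ω t := by unfold weight; positivity

theorem continuous_weight (ω : ℝ) : Continuous (weight ω) := by unfold weight; fun_prop

theorem integrable_weight_sq {ω : ℝ} (hω : 0 < ω) : Integrable (fun t => weight ω t ^ 2) := by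
  -- From `exp s ≥ s⁴ / 4!` with `s = ω (1 + |t|)`: two of the four powers absorb the polynomial in
  -- the weight, the other two give the decay.
  have hbound : ∀ t : ℝ, weight ω t ≤ 24 / ω ^ 4 * Real.exp ω * (1 + t ^ 2)⁻¹ := fun t => by
    have h1 := Real.pow_div_factorial_le_exp (ω * (1 + |t|)) (by positivity) 4
    have h2 : (1 + |t|) ^ 4 ≤ 24 / ω ^ 4 * Real.exp ω * Real.exp (ω * |t|) := by
      rw [mul_assoc, ← Real.exp_add]
      have : ω + ω * |t| = ω * (1 + |t|) := by ring
      rw [this, div_mul_eq_mul_div, le_div_iff₀ (by positivity)]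
      have e : ((4).factorial : ℝ) = 24 := by norm_num [Nat.factorial]
      rw [e, mul_pow, div_le_iff₀ (by norm_num)] at h1
      linarith
    have h3 : 1 + t ^ 2 ≤ (1 + |t|) ^ 2 := by
      nlinarith [abs_nonneg t, sq_abs t]
    rw [weight, Real.exp_neg, ← div_eq_mul_inv, ← div_eq_mul_inv, div_le_div_iff₀ (by positivity)
      (by positivity)]
    calc (1 + |t|) ^ 2 * (1 + t ^ 2) ≤ (1 + |t|) ^ 2 * (1 + |t|) ^ 2 := by gcongr
      _ = (1 + |t|) ^ 4 := by ring
      _ ≤ _ := h2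
  refine (integrable_inv_one_add_sq.const_mul ((24 / ω ^ 4 * Real.exp ω) ^ 2)).mono'
    ((continuous_weight ω).pow 2).aestronglyMeasurable (Eventually.of_forall fun t => ?_)
  rw [Real.norm_of_nonneg (by positivity)]
  refine (pow_le_pow_left₀ (weight_nonneg ω t) (hbound t) 2).trans ?_
  rw [mul_pow]
  gcongr
  exact pow_le_of_le_one (by positivity)
    (inv_le_one_of_one_le₀ (by nlinarith [sq_nonneg t])) two_ne_zero

theorem norm_toLp_sq {F : ℝ × ℝ → ℂ} (h : MemLp F 2 volume) :
    ‖h.toLp F‖ ^ 2 = ∫ p, ‖F p‖ ^ 2 := by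
  have h1 := inner_toLp h h
  rw [inner_self_eq_norm_sq_to_K] at h1
  have h2 : ∫ p, conj (F p) * F p = ((∫ p, ‖F p‖ ^ 2 : ℝ) : ℂ) := by
    rw [← integral_complex_ofReal]
    refine integral_congr_ae (Eventually.of_forall fun p => ?_)
    simp only [Complex.conj_mul']
    push_cast
    rfl
  rw [h2] at h1
  exact Complex.ofReal_injective ((Complex.ofReal_pow _ _).trans h1)

/-- Functions supported in the strip `N ≤ y ≤ 2 N` and bounded by a multiple of the weight scaled by
`1 / N` are bounded in `L²` uniformly in `N`. -/
theorem memLp_of_le_weight {ω : ℝ} (hω : 0 < ω) {N K : ℝ} (hN : 0 < N) {F : ℝ × ℝ → ℂ}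
    (hF : Measurable F)
    (h0 : ∀ p : ℝ × ℝ, p.1 ≠ 0 → p.2 ∉ Icc N (2 * N) → F p = 0)
    (hle : ∀ p : ℝ × ℝ, p.1 ≠ 0 → p.2 ∈ Icc N (2 * N) → ‖F p‖ ≤ K * weight ω (N * p.1)) :
    ∃ h : MemLp F 2 volume, ‖h.toLp F‖ ^ 2 ≤ K ^ 2 * ∫ t, weight ω t ^ 2 := by
  have hi1 : Integrable (fun x => K ^ 2 * weight ω (N * x) ^ 2) :=
    ((integrable_weight_sq hω).comp_mul_left' hN.ne').const_mul _
  have hi2 : Integrable ((Icc N (2 * N)).indicator fun _ : ℝ => (1 : ℝ)) := by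
    rw [integrable_indicator_iff measurableSet_Icc]
    simp
  have hi := hi1.mul_prod hi2
  rw [← Measure.volume_eq_prod] at hi
  have hb : ∀ᵐ p : ℝ × ℝ, ‖F p‖ ^ 2 ≤
      K ^ 2 * weight ω (N * p.1) ^ 2 * (Icc N (2 * N)).indicator (fun _ => 1) p.2 := by
    filter_upwards [ae_fst_ne_zero] with p hp
    by_cases hy : p.2 ∈ Icc N (2 * N)
    · rw [indicator_of_mem hy, mul_one, ← mul_pow]
      exact pow_le_pow_left₀ (norm_nonneg _) (hle p hp hy) 2
    · rw [h0 p hp hy, indicator_of_notMem hy]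
      simp
  have hsq : Integrable (fun p => ‖F p‖ ^ 2) := by
    refine hi.mono' (hF.norm.pow_const 2).aestronglyMeasurable ?_
    filter_upwards [hb] with p hp
    rwa [Real.norm_of_nonneg (by positivity)]
  have hm : MemLp F 2 volume := (memLp_two_iff_integrable_sq_norm hF.aestronglyMeasurable).2 hsq
  refine ⟨hm, ?_⟩
  rw [norm_toLp_sq]
  refine (integral_mono_ae hsq hi hb).trans_eq ?_
  -- The substitution `t = N x` contributes `1 / N` and the strip has length `N`; the two factors
  -- cancel.
  rw [Measure.volume_eq_prod, integral_prod_mul (fun x => K ^ 2 * weight ω (N * x) ^ 2),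
    integral_const_mul, Measure.integral_comp_mul_left (fun t => weight ω t ^ 2),
    integral_indicator_const _ measurableSet_Icc]
  have : volume.real (Icc N (2 * N)) = N := by
    rw [Real.volume_real_Icc_of_le (by linarith)]; ring
  rw [this, abs_of_pos (inv_pos.2 hN)]
  simp only [smul_eq_mul, mul_one]
  field_simp

theorem measurable_momentum {a : ℝ × ℝ → ℝ} (ha : Continuous a) {e : ℝ × ℝ} {v : ℝ × ℝ → ℂ}
    (hv : Measurable v) : Measurable (momentum a e v) :=
  ((measurable_fderiv_apply_const ℝ v e).const_mul _).add
    ((Complex.measurable_ofReal.comp ha.measurable).mul hv)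

theorem measurable_hamiltonian (A : VectorPotential B) (ω : ℝ) {v : ℝ × ℝ → ℂ}
    (hv : Measurable v) : Measurable (hamiltonian A ω v) := by
  have h1 := A.contDiff₁.continuous
  have h2 := A.contDiff₂.continuous
  have h3 : Measurable fun p : ℝ × ℝ => ((ω ^ 2 * p.2 ^ 2 : ℝ) : ℂ) :=
    Complex.measurable_ofReal.comp (by fun_prop)
  exact ((measurable_momentum h1 (measurable_momentum h1 hv)).add
    (measurable_momentum h2 (measurable_momentum h2 hv))).add (h3.mul hv)

/-- In the strip `y ≥ N`, so the decay in `x` is at least that of `exp(-ω |N x|)`. -/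
theorem exp_le_weight {ω : ℝ} (hω : 0 < ω) {N : ℝ} (hN : 1 ≤ N) {p : ℝ × ℝ} (hp : N ≤ p.2) {D : ℝ}
    (hD : 0 ≤ D) :
    D * (1 + |N * p.1|) ^ 2 * Real.exp (-(ω * (p.2 * |p.1|))) ≤ D * weight ω (N * p.1) := by
  rw [weight, mul_assoc]
  gcongr
  rw [abs_mul, abs_of_pos (by linarith)]
  gcongr

section Weyl

variable {A : VectorPotential B} {χ : ℝ × ℝ → ℝ} {ω k N C : ℝ} {f f₁ f₂ : ℝ → ℝ}

theorem norm_landau_coeff_le (hω : 0 < ω) (B : ℝ) (x : ℝ) :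
    ‖(B - Complex.I * sgn x * ω : ℂ)‖ ≤ |B| + ω := by
  refine (norm_sub_le _ _).trans ?_
  rw [norm_mul, norm_mul, Complex.norm_I, Complex.norm_real, Complex.norm_real, Complex.norm_real,
    Real.norm_eq_abs, Real.norm_eq_abs, Real.norm_eq_abs, abs_sgn, abs_of_pos hω]
  simp

/-- The remainder `(H - k²) v` of a Weyl function is of order `1 / N`. -/
theorem norm_weylFun_remainder_le (hω : 0 < ω) (hχ : ContDiff ℝ 2 χ)
    (hA : ∀ p, fderiv ℝ χ p (1, 0) = A.A₁ p ∧ fderiv ℝ χ p (0, 1) = A.A₂ p - B * p.1 + k)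
    (hf : ∀ y, HasDerivAt f (f₁ y) y) (hf₁ : ∀ y, HasDerivAt f₁ (f₂ y) y) (hN : 1 ≤ N)
    (hC : 0 ≤ C) (h0 : ∀ y, |f y| ≤ C) (h1 : ∀ y, |f₁ y| ≤ C / N) (h2 : ∀ y, |f₂ y| ≤ C / N)
    {p : ℝ × ℝ} (hp : p.1 ≠ 0) (hy : N ≤ p.2) :
    ‖hamiltonian A ω (weylFun χ ω f) p - k ^ 2 * weylFun χ ω f p‖ ≤
      C * (1 + 2 * (|B| + ω + |k|) + (|B| + ω) ^ 2 + 2 * |k| * (|B| + ω)) / N *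
        weight ω (N * p.1) := by
  have hN0 : 0 < N := by linarith
  set M := |B| + ω with hM
  have hM0 : 0 ≤ M := by positivity
  set c : ℂ := B - Complex.I * sgn p.1 * ω with hc
  have hcM : ‖c‖ ≤ M := norm_landau_coeff_le hω B p.1
  set t := |N * p.1| with ht
  have ht0 : 0 ≤ t := abs_nonneg _
  have hx : |p.1| = t / N := by
    rw [ht, abs_mul, abs_of_pos hN0, mul_div_cancel_left₀ _ hN0.ne']
  have hxt : |p.1| ≤ t := by rw [hx]; exact div_le_self ht0 hN
  -- Only one of the two factors `|x| = t / N` is used at full strength; the other is bounded by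
  -- `t`. This leaves a single `1 / N` in common with the other terms.
  have hxx : |p.1| ^ 2 ≤ t ^ 2 / N := by
    calc |p.1| ^ 2 = |p.1| * |p.1| := sq _
      _ ≤ t * (t / N) := by
        nth_rewrite 2 [hx]
        gcongr
      _ = _ := by ring
  rw [weylFun_hamiltonian hχ hA hf hf₁ hp, norm_mul, norm_exp_phase]
  refine le_trans ?_ (exp_le_weight hω hN hy (by positivity))
  refine mul_le_mul_of_nonneg_right ?_ (Real.exp_nonneg _)
  have e1 : ‖(-f₂ p.2 : ℂ)‖ ≤ C / N := by
    rw [norm_neg, Complex.norm_real]; exact h2 _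
  have e2 : ‖2 * Complex.I * (c * p.1 - k) * f₁ p.2‖ ≤ 2 * (M * t + |k|) * (C / N) := by
    rw [norm_mul, norm_mul, norm_mul, Complex.norm_I, Complex.norm_real]
    have : ‖c * p.1 - k‖ ≤ M * t + |k| := by
      refine (norm_sub_le _ _).trans ?_
      rw [norm_mul, Complex.norm_real, Complex.norm_real, Real.norm_eq_abs, Real.norm_eq_abs]
      gcongr
    norm_num
    gcongr
    exact h1 _
  have e3 : ‖(c ^ 2 * p.1 ^ 2 - 2 * k * c * p.1) * f p.2‖ ≤
      (M ^ 2 * (t ^ 2 / N) + 2 * |k| * M * (t / N)) * C := by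
    rw [norm_mul, Complex.norm_real]
    have : ‖c ^ 2 * p.1 ^ 2 - 2 * k * c * p.1‖ ≤ M ^ 2 * (t ^ 2 / N) + 2 * |k| * M * (t / N) := by
      refine (norm_sub_le _ _).trans ?_
      rw [norm_mul, norm_mul, norm_mul, norm_mul, norm_pow, norm_pow, Complex.norm_real,
        Complex.norm_real, Real.norm_eq_abs, Real.norm_eq_abs, ← hx, Complex.norm_ofNat]
      gcongr
    gcongr
    exact h0 _
  refine (norm_add₃_le.trans (add_le_add (add_le_add e1 e2) e3)).trans ?_
  have e4 : C / N + 2 * (M * t + |k|) * (C / N) + (M ^ 2 * (t ^ 2 / N) + 2 * |k| * M * (t / N)) * C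
      = C / N * (1 + 2 * (M * t + |k|) + M ^ 2 * t ^ 2 + 2 * |k| * M * t) := by
    field_simp
    ring
  have e5 : C * (1 + 2 * (M + |k|) + M ^ 2 + 2 * |k| * M) / N * (1 + t) ^ 2 =
      C / N * ((1 + 2 * (M + |k|) + M ^ 2 + 2 * |k| * M) * (1 + t) ^ 2) := by
    field_simp
  rw [e4, e5]
  have hk := abs_nonneg k
  have hkM : 0 ≤ |k| * M := by positivity
  refine mul_le_mul_of_nonneg_left ?_ (by positivity)
  nlinarith [mul_nonneg hM0 ht0, mul_nonneg hk ht0, mul_nonneg hkM ht0, mul_nonneg hM0 (sq_nonneg t),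
    mul_nonneg hk (sq_nonneg t), mul_nonneg hkM (sq_nonneg t), mul_nonneg (sq_nonneg M) ht0,
    sq_nonneg t]

theorem norm_weylFun (χ : ℝ × ℝ → ℝ) (ω : ℝ) (f : ℝ → ℝ) (p : ℝ × ℝ) :
    ‖weylFun χ ω f p‖ = |f p.2| * Real.exp (-(ω * (p.2 * |p.1|))) := by
  rw [weylFun, planeFun, norm_mul, norm_exp_phase, Complex.norm_real, Real.norm_eq_abs]

theorem weylFun_continuous (hχ : ContDiff ℝ 2 χ) (hf : ContDiff ℝ 2 f) :
    Continuous (weylFun χ ω f) := by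
  have hc := ((planeFun_contDiff (ω := ω) (s := 1) hχ hf).continuous.continuousOn.congr
      fun p hp => weylFun_right hp).union_of_isClosed
    ((planeFun_contDiff (ω := ω) (s := -1) hχ hf).continuous.continuousOn.congr
      fun p hp => weylFun_left hp)
    (isClosed_le continuous_const continuous_fst) (isClosed_le continuous_fst continuous_const)
  rw [← continuousOn_univ]
  exact hc.mono fun p _ => le_total 0 p.1

/-- The Weyl functions belong to the initial domain; their `L²` norms are bounded below and the
remainders `(H - k²) v` are of order `1 / N` in `L²`. -/
theorem weylFun_memD0 (hω : 0 < ω) (hχ : ContDiff ℝ 2 χ)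
    (hA : ∀ p, fderiv ℝ χ p (1, 0) = A.A₁ p ∧ fderiv ℝ χ p (0, 1) = A.A₂ p - B * p.1 + k)
    (hf2 : ContDiff ℝ 2 f)
    (hf : ∀ y, HasDerivAt f (f₁ y) y) (hf₁ : ∀ y, HasDerivAt f₁ (f₂ y) y) (hN : 1 ≤ N)
    (hC : 0 ≤ C) (h0 : ∀ y, |f y| ≤ C) (h1 : ∀ y, |f₁ y| ≤ C / N) (h2 : ∀ y, |f₂ y| ≤ C / N)
    (hs : ∀ y, y ∉ Icc N (2 * N) → f y = 0 ∧ f₁ y = 0 ∧ f₂ y = 0) :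
    ∃ h : MemD0 A ω (-2 * ω) (weylFun χ ω f),
      ‖h.memLp_hamiltonian.toLp _ - ((k ^ 2 : ℝ) : ℂ) • h.memLp.toLp _‖ ^ 2 ≤
        (C * (1 + 2 * (|B| + ω + |k|) + (|B| + ω) ^ 2 + 2 * |k| * (|B| + ω)) / N) ^ 2 *
          ∫ t, weight ω t ^ 2 := by
  have hN0 : 0 < N := by linarith
  have hcont := weylFun_continuous (ω := ω) hχ hf2
  have hmeas := hcont.measurable
  have hw : ∀ {p : ℝ × ℝ}, p.2 ∉ Icc N (2 * N) → weylFun χ ω f p = 0 := fun hp => by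
    simp [weylFun, planeFun, (hs _ hp).1]
  have hone : ∀ p : ℝ × ℝ, (1 : ℝ) ≤ (1 + |N * p.1|) ^ 2 := fun p =>
    one_le_pow₀ (by linarith [abs_nonneg (N * p.1)])
  have hexp : ∀ {p : ℝ × ℝ} {D : ℝ}, 0 ≤ D → N ≤ p.2 →
      D * Real.exp (-(ω * (p.2 * |p.1|))) ≤ D * weight ω (N * p.1) := fun {p D} hD hp =>
    (mul_le_mul_of_nonneg_right (le_mul_of_one_le_right hD (hone p)) (Real.exp_nonneg _)).trans
      (exp_le_weight hω hN hp hD)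
  obtain ⟨m0, -⟩ := memLp_of_le_weight (K := C) hω hN0 hmeas (fun p _ hy => hw hy)
    (fun p _ hy => by
      rw [norm_weylFun]
      exact (mul_le_mul_of_nonneg_right (h0 _) (Real.exp_nonneg _)).trans (hexp hC hy.1))
  obtain ⟨my, -⟩ := memLp_of_le_weight (F := fun p => (p.2 : ℂ) * weylFun χ ω f p)
    (K := 2 * N * C) hω hN0
    ((Complex.measurable_ofReal.comp measurable_snd).mul hmeas)
    (fun p _ hy => by rw [hw hy, mul_zero])
    (fun p _ hy => by
      rw [norm_mul, norm_weylFun, Complex.norm_real, Real.norm_eq_abs,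
        abs_of_nonneg (hN0.le.trans hy.1), ← mul_assoc]
      refine le_trans ?_ (hexp (by positivity) hy.1)
      gcongr
      exacts [hy.2, h0 _])
  obtain ⟨mX, -⟩ := memLp_of_le_weight (F := momentumX A (weylFun χ ω f))
    (K := ω * (2 * N * C)) hω hN0
    (measurable_momentum A.contDiff₁.continuous hmeas)
    (fun p hp hy => by
      rw [momentumX, (momentum_congr (weylFun_eventuallyEq χ ω f hp)).eq_of_nhds]
      change momentumX A _ p = 0
      rw [momentumX_planeFun hχ (fun p => (hA p).1) hf]
      simp [(hs _ hy).1])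
    (fun p hp hy => by
      rw [momentumX, (momentum_congr (weylFun_eventuallyEq χ ω f hp)).eq_of_nhds]
      change ‖momentumX A _ p‖ ≤ _
      rw [momentumX_planeFun hχ (fun p => (hA p).1) hf]
      refine le_trans ?_ (hexp (by positivity) hy.1)
      rw [norm_mul, norm_exp_phase, norm_mul, norm_mul, norm_mul, norm_mul, norm_neg,
        Complex.norm_I, Complex.norm_real, Complex.norm_real, Complex.norm_real, Complex.norm_real,
        Real.norm_eq_abs, Real.norm_eq_abs, Real.norm_eq_abs, Real.norm_eq_abs, abs_sgn,
        abs_of_pos hω, abs_of_nonneg (hN0.le.trans hy.1), one_mul, one_mul]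
      gcongr
      exacts [hy.2, h0 _])
  obtain ⟨mY, -⟩ := memLp_of_le_weight (F := momentumY A (weylFun χ ω f))
    (K := C + (|B| + ω + |k|) * C) hω hN0
    (measurable_momentum A.contDiff₂.continuous hmeas)
    (fun p hp hy => by
      rw [momentumY, (momentum_congr (weylFun_eventuallyEq χ ω f hp)).eq_of_nhds]
      change momentumY A _ p = 0
      rw [momentumY_planeFun hχ (fun p => (hA p).2) hf]
      simp [(hs _ hy).1, (hs _ hy).2.1])
    (fun p hp hy => by
      rw [momentumY, (momentum_congr (weylFun_eventuallyEq χ ω f hp)).eq_of_nhds]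
      change ‖momentumY A _ p‖ ≤ _
      rw [momentumY_planeFun hχ (fun p => (hA p).2) hf, norm_mul, norm_exp_phase]
      refine le_trans ?_ (exp_le_weight hω hN hy.1 (by positivity))
      refine mul_le_mul_of_nonneg_right ?_ (Real.exp_nonneg _)
      have hM : 0 ≤ |B| + ω := by positivity
      have hx : |p.1| ≤ |N * p.1| := by
        rw [abs_mul, abs_of_pos hN0]
        exact le_mul_of_one_le_left (abs_nonneg _) hN
      have hk := abs_nonneg k
      have hb : (|B| + ω) * |p.1| + |k| ≤ (|B| + ω + |k|) * (1 + |N * p.1|) ^ 2 := by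
        have := abs_nonneg (N * p.1)
        nlinarith [mul_le_mul_of_nonneg_left hx hM, mul_nonneg hM this, mul_nonneg hk this,
          mul_nonneg hM (sq_nonneg |N * p.1|), mul_nonneg hk (sq_nonneg |N * p.1|)]
      have e1 : ‖Complex.I * f₁ p.2‖ ≤ C * (1 + |N * p.1|) ^ 2 := by
        rw [norm_mul, Complex.norm_I, one_mul, Complex.norm_real]
        exact ((h1 _).trans (div_le_self hC hN)).trans (le_mul_of_one_le_right hC (hone p))
      have e2 : ‖((B - Complex.I * sgn p.1 * ω) * p.1 - k) * (f p.2 : ℂ)‖ ≤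
          (|B| + ω + |k|) * (1 + |N * p.1|) ^ 2 * C := by
        rw [norm_mul, Complex.norm_real]
        refine mul_le_mul ?_ (h0 _) (norm_nonneg _) (by positivity)
        refine ((norm_sub_le _ _).trans ?_).trans hb
        rw [norm_mul, Complex.norm_real, Complex.norm_real, Real.norm_eq_abs, Real.norm_eq_abs]
        gcongr
        exact norm_landau_coeff_le hω B p.1
      refine ((norm_add_le _ _).trans (add_le_add e1 e2)).trans_eq ?_
      ring)
  obtain ⟨mR, hR⟩ := memLp_of_le_weight
    (F := fun p => hamiltonian A ω (weylFun χ ω f) p - k ^ 2 * weylFun χ ω f p) hω hN0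
    ((measurable_hamiltonian A ω hmeas).sub (hmeas.const_mul _))
    (fun p hp hy => by
      obtain ⟨y0, y1, y2⟩ := hs _ hy
      rw [weylFun_hamiltonian hχ hA hf hf₁ hp, y0, y1, y2]
      simp)
    (fun p hp hy => norm_weylFun_remainder_le hω hχ hA hf hf₁ hN hC h0 h1 h2 hp hy.1)
  -- Square integrability of `H v` is read off from that of the remainder and of `v`.
  have mH : MemLp (hamiltonian A ω (weylFun χ ω f)) 2 volume :=
    (mR.add (m0.const_mul ((k : ℂ) ^ 2))).ae_eq (Eventually.of_forall fun p => by simp)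
  refine ⟨⟨(planeFun_contDiff hχ hf2).contDiffOn.congr fun p hp => weylFun_right hp,
    (planeFun_contDiff hχ hf2).contDiffOn.congr fun p hp => weylFun_left hp,
    weylFun_jump hχ hf, m0, mX, mY, my, mH⟩, ?_⟩
  convert hR using 3
  rw [← MemLp.toLp_const_smul, ← MemLp.toLp_sub, MemLp.toLp_eq_toLp_iff]
  refine Eventually.of_forall fun p => ?_
  simp

theorem norm_weylFun_toLp_ge (hω : 0 < ω) (hN : 1 ≤ N)
    (hf : ∀ y ∈ Icc (5 / 4 * N) (7 / 4 * N), f y = 1) (h : MemLp (weylFun χ ω f) 2 volume) :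
    Real.exp (-(2 * ω)) ^ 2 ≤ ‖h.toLp _‖ ^ 2 := by
  have hN0 : 0 < N := by linarith
  rw [norm_toLp_sq]
  have hi := (memLp_two_iff_integrable_sq_norm h.1).1 h
  -- A rectangle of area `(2 / N) (N / 2) = 1` on which `f = 1` and `y |x| ≤ 2`, so the function has
  -- modulus at least `exp(-2 ω)`.
  set S : Set (ℝ × ℝ) := Icc (-N⁻¹) N⁻¹ ×ˢ Icc (5 / 4 * N) (7 / 4 * N) with hS
  have hSm : MeasurableSet S := measurableSet_Icc.prod measurableSet_Icc
  have hvol : volume S = 1 := by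
    rw [hS, Measure.volume_eq_prod, Measure.prod_prod, Real.volume_Icc, Real.volume_Icc,
      ← ENNReal.ofReal_mul (by rw [sub_neg_eq_add]; positivity), ENNReal.ofReal_eq_one]
    field_simp
    norm_num
  have hge : ∀ p ∈ S, Real.exp (-(2 * ω)) ^ 2 ≤ ‖weylFun χ ω f p‖ ^ 2 := by
    rintro p ⟨hx, hy⟩
    rw [norm_weylFun, hf _ hy, abs_one, one_mul]
    have h1 : |p.1| ≤ N⁻¹ := abs_le.2 hx
    have h2 : p.2 * |p.1| ≤ 2 := by
      calc p.2 * |p.1| ≤ 2 * N * N⁻¹ :=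
            mul_le_mul (hy.2.trans (by linarith)) h1 (abs_nonneg _) (by positivity)
        _ = 2 := by field_simp
    exact pow_le_pow_left₀ (Real.exp_nonneg _) (Real.exp_le_exp.2 (by nlinarith)) 2
  have h1 := setIntegral_ge_of_const_le_real hSm (by rw [hvol]; simp) hge hi.integrableOn
  rw [Measure.real, hvol] at h1
  simp only [ENNReal.toReal_one, mul_one] at h1
  exact h1.trans (setIntegral_le_integral hi (Eventually.of_forall fun p => by positivity))

end Weyl

/-! ### The spectrum of the Friedrichs extension -/

/-- The initial operator has approximate eigenvectors for every `t ≥ 0`. -/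
theorem exists_approx_eigenvector (A : VectorPotential B) {ω : ℝ} (hω : 0 < ω) {t : ℝ}
    (ht : 0 ≤ t) {ε : ℝ} (hε : 0 < ε) : ∃ u : (initialOperator A ω (-2 * ω)).domain,
      ‖initialOperator A ω (-2 * ω) u - (t : ℂ) • (u : L2Plane)‖ < ε * ‖(u : L2Plane)‖ := by
  obtain ⟨C, hC, hprof⟩ := exists_profile
  obtain ⟨χ, hχ, hA⟩ := A.exists_gauge √t
  set D := C * (1 + 2 * (|B| + ω + |√t|) + (|B| + ω) ^ 2 + 2 * |√t| * (|B| + ω)) with hD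
  set J := √(∫ s, weight ω s ^ 2) with hJ
  have hD0 : 0 ≤ D := by positivity
  have hJ2 : J ^ 2 = ∫ s, weight ω s ^ 2 :=
    Real.sq_sqrt (integral_nonneg fun s => by positivity)
  -- Ensures `D J / N < ε exp(-2 ω)`, that is, remainder below `ε` times the lower bound of the
  -- norm. The `+ 1` gives strictness and `N ≥ 1`.
  set N := D * J / (ε * Real.exp (-(2 * ω))) + 1 with hNdef
  have hE := Real.exp_pos (-(2 * ω))
  have hN : 1 ≤ N := le_add_of_nonneg_left (by positivity)
  have hN0 : 0 < N := by linarith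
  obtain ⟨f, f₁, f₂, hf2, hf, hf₁, h0, h1, h2, hs, hone⟩ := hprof N hN
  obtain ⟨hm, hle⟩ := weylFun_memD0 hω hχ hA hf2 hf hf₁ hN hC h0 h1 h2 hs
  refine ⟨⟨_, mem_initialOperator_domain hm⟩, ?_⟩
  rw [initialOperator_apply hm]
  rw [Real.sq_sqrt ht, ← hJ2, ← mul_pow] at hle
  have hle' := (abs_le_of_sq_le_sq' hle (by positivity)).2
  have hge := (abs_le_of_sq_le_sq' (norm_weylFun_toLp_ge hω hN hone hm.memLp) (norm_nonneg _)).2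
  refine (hle'.trans_lt ?_).trans_le (mul_le_mul_of_nonneg_left hge hε.le)
  rw [div_mul_eq_mul_div, div_lt_iff₀ hN0, ← div_lt_iff₀' (by positivity), hNdef]
  exact lt_add_one _

/-- Approximate eigenvectors of the initial operator serve for its extension too, so Weyl's
criterion applies without identifying the extended domain. -/
theorem spectrumSet_friedrichs (A : VectorPotential B) {ω : ℝ} (hω : 0 < ω)
    (h : (initialOperator A ω (-2 * ω)).IsNonnegSymmetric) :
    ((initialOperator A ω (-2 * ω)).friedrichs h).spectrumSet =
      (fun t : ℝ => (t : ℂ)) '' Ici 0 := by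
  refine Subset.antisymm ((LinearPMap.friedrichs_isSelfAdjoint h).spectrumSet_subset
    (LinearPMap.friedrichs_inner_nonneg h)) ?_
  rintro _ ⟨t, ht, rfl⟩
  refine LinearPMap.mem_spectrumSet_of_approx fun ε hε => ?_
  obtain ⟨u, hu⟩ := exists_approx_eigenvector A hω ht hε
  have hle := LinearPMap.le_friedrichs h
  refine ⟨⟨u, hle.1 u.2⟩, ?_⟩
  rwa [← hle.2 (x := u) (y := ⟨u, hle.1 u.2⟩) rfl]

end SmilanskySolomyak

end

theorem mainTheorem3 (ω B lam : ℝ) (hω : 0 < ω) (hB : 0 < B) (hlam : lam = -2 * ω)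
    (A : SmilanskySolomyak.VectorPotential B) :
    ∃ h : (SmilanskySolomyak.initialOperator A ω lam).IsNonnegSymmetric,
      IsSelfAdjoint ((SmilanskySolomyak.initialOperator A ω lam).friedrichs h) ∧
      ((SmilanskySolomyak.initialOperator A ω lam).friedrichs h).spectrumSet =
        (fun t : ℝ => (t : ℂ)) '' Set.Ici 0 ∧
      ((SmilanskySolomyak.initialOperator A ω lam).friedrichs h).essentialSpectrum =
        (fun t : ℝ => (t : ℂ)) '' Set.Ici 0 := by
  subst hlam
  have h := SmilanskySolomyak.initialOperator_isNonnegSymmetric A (ω := ω) rfl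
  have hspec := SmilanskySolomyak.spectrumSet_friedrichs A hω h
  exact ⟨h, LinearPMap.friedrichs_isSelfAdjoint h, hspec,
    LinearPMap.essentialSpectrum_eq_of_spectrumSet_eq hspec⟩
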